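/- Let $\mathbf t=(t_n)_{n}$ be a summable sequence of strictly positive real numbers. Let $\mu_{\mathbf t}$ be the Gaussian measure on $\ell^2=\ell^2(\mathbb N)$ obtained by restricting to $\ell^2$ (a set of full measure) the product on $\mathbb C^\infty$ of the measures $(\pi t_n)^{-1}e^{-|z|^2/t_n}\,dV(z)$ on $\mathbb C$. Let $F_{\mathbf t}^2(\ell^2)\subset L^2(\ell^2,\mu_{\mathbf t})$ be the closure of the analytic polynomials (in finitely many of the variables $z_1,z_2,\dots$), with orthogonal projection $P$. For $\varphi\in L^\infty(\ell^2,\mu_{\mathbf t})$ let $T_\varphi g=P(\varphi g)$ be the Toeplitz operator on $F_{\mathbf t}^2(\ell^2)$. Put $$\mathcal H_{1/2}=\Big\{z\in\ell^2:\ \|z\|_{1/2}^2=\sum_n\tfrac{|z_n|^2}{t_n}<\infty\Big\},\quad \mathcal H_1=\Big\{z\in\ell^2:\ \sum_n\tfrac{|z_n|^2}{t_n^2}<\infty\Big\},$$ $$\langle w,z\rangle_{1/2}=\sum_n \frac{w_n\overline{z_n}}{t_n},\qquad \sigma_{\mathbf t}=\operatorname{Im}\langle\cdot,\cdot\rangle_{1/2}.$$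 For $z\in\mathcal H_{1/2}$ the functions $\langle\cdot,z\rangle_{1/2}$ and $\sigma_{\mathbf t}(\cdot,z)=\operatorname{Im}\langle\cdot,z\rangle_{1/2}$ on $\ell^2$ are defined $\mu_{\mathbf t}$-almost everywhere, through convergence of the series in $L^2(\ell^2,\mu_{\mathbf t})$. There is exactly one family $(W_z)_{z\in\mathcal H_{1/2}}$ of bounded operators on $F_{\mathbf t}^2(\ell^2)$ that is continuous from $(\mathcal H_{1/2},\|\cdot\|_{1/2})$ to the strong operator topology and satisfies $$(W_zp)(w)=e^{\langle w,z\rangle_{1/2}-\frac12\|z\|_{1/2}^2}\,p(w-z)\quad\text{for a.e. } w\in\ell^2$$ for all $z\in\mathcal H_1$ and all analytic polynomials $p$. These Weyl operators are unitary and satisfy $W_zW_w=e^{-i\sigma_{\mathbf t}(z,w)}W_{z+w}$ for $z,w\in\mathcal H_{1/2}$. If $A_z$ denotes the operator such that $iA_z$ is the infinitesimal generator of $s\mapsto W_{sz}$, then the resolvent $R(\lambda,z)=(A_z-i\lambda)^{-1}$ exists as a bounded operator for all $z\in\mathcal H_{1/2}$ and $\lambda\in\mathbb C\setminus i\mathbb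 R$. Let $\mathcal R(\mathcal H_{1/2},\sigma_{\mathbf t})$ be the C*-algebra generated by all $R(\lambda,z)$, $\lambda\in\mathbb C\setminus i\mathbb R$, $z\in\mathcal H_{1/2}$ (the representation of the resolvent algebra of $(\mathcal H_{1/2},\sigma_{\mathbf t})$ on $F_{\mathbf t}^2(\ell^2)$). Let $\mathcal R_{cl}^{\mathbf t}\subset L^\infty(\ell^2,\mu_{\mathbf t})$ be the C*-algebra generated by the functions $(\lambda-2i\sigma_{\mathbf t}(\cdot,z))^{-1}$, $\lambda\in\mathbb C\setminus i\mathbb R$, $z\in\mathcal H_{1/2}$, and let $\mathcal T^{\mathbf t}(\mathcal R_{cl}^{\mathbf t})$ be the C*-algebra generated by the Toeplitz operators $T_\varphi$ with $\varphi\in\mathcal R_{cl}^{\mathbf t}$. Then $$\mathcal R(\mathcal H_{1/2},\sigma_{\mathbf t})\subset\mathcal T^{\mathbf t}(\mathcal R_{cl}^{\mathbf t}).$$ -/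

import Mathlib

open MeasureTheory Filter Topology
open scoped ENNReal ComplexConjugate

noncomputable section

namespace FockBargmann

/-- A summable sequence `t = (t_n)` of strictly positive real numbers. -/
structure WeightSequence where
  val : ℕ → ℝ
  pos : ∀ n, 0 < val n
  summable : Summable val

/-- The Hilbert space `ℓ²(ℕ)` of square summable complex sequences. -/
abbrev Ell2 : Type := lp (fun _ : ℕ => ℂ) 2

instance : MeasurableSpace Ell2 := borel Ell2

instance : BorelSpace Ell2 := ⟨rfl⟩

/-! ### The Gaussian measure -/

/-- The Gaussian measure on `ℂ` with Lebesgue density `(π r)⁻¹ exp (-|z|² / r)`. -/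
def gaussianC (r : ℝ) : Measure ℂ :=
  volume.withDensity fun z => ENNReal.ofReal ((Real.pi * r)⁻¹ * Real.exp (-(‖z‖ ^ 2 / r)))

/-- The infinite product of the Gaussian measures with parameters `t_n`, on `ℂ^∞`. -/
def gaussianProd (t : WeightSequence) : Measure (ℕ → ℂ) :=
  Measure.infinitePi fun n => gaussianC (t.val n)

/-- The centered Gaussian measure on `ℓ²`: the restriction to `ℓ² ⊆ ℂ^∞` of the product measure,
which is concentrated on `ℓ²`. -/
def gaussian (t : WeightSequence) : Measure Ell2 :=
  (gaussianProd t).comap fun z n => z n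

lemma lintegral_exp_sq {c : ℝ} (hc : 0 < c) :
    ∫⁻ z : ℂ, ENNReal.ofReal (Real.exp (-c * ‖z‖ ^ 2)) = ENNReal.ofReal (Real.pi / c) := by
  have h := GaussianFourier.integral_rexp_neg_mul_sq_norm (V := ℂ) hc
  have hpos : 0 < Real.pi / c := div_pos Real.pi_pos hc
  rw [Complex.finrank_real_complex] at h
  norm_num at h
  rw [← h, ofReal_integral_eq_lintegral_ofReal]
  · simp
  · by_contra hn
    have := integral_undef hn
    rw [this] at h
    exact hpos.ne h
  · exact ae_of_all _ fun z => (Real.exp_pos _).le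

/-- Exponential moment of the Gaussian measure, which bounds all its moments. -/
lemma lintegral_exp_gaussianC {r : ℝ} (hr : 0 < r) {a : ℝ} (ha : a < 1) :
    ∫⁻ z : ℂ, ENNReal.ofReal (Real.exp (a * (‖z‖ ^ 2 / r))) ∂(gaussianC r)
      = ENNReal.ofReal (1 - a)⁻¹ := by
  have h1 : 0 < 1 - a := by linarith
  have hm : Measurable fun z : ℂ =>
      ENNReal.ofReal ((Real.pi * r)⁻¹ * Real.exp (-(‖z‖ ^ 2 / r))) := by fun_prop
  rw [gaussianC, lintegral_withDensity_eq_lintegral_mul _ hm (by fun_prop)]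
  have : ∀ z : ℂ, ((fun z : ℂ =>
      ENNReal.ofReal ((Real.pi * r)⁻¹ * Real.exp (-(‖z‖ ^ 2 / r)))) *
      fun z : ℂ => ENNReal.ofReal (Real.exp (a * (‖z‖ ^ 2 / r)))) z
      = ENNReal.ofReal ((Real.pi * r)⁻¹)
        * ENNReal.ofReal (Real.exp (-((1 - a) / r) * ‖z‖ ^ 2)) := by
    intro z
    simp only [Pi.mul_apply]
    rw [← ENNReal.ofReal_mul (by positivity), ← ENNReal.ofReal_mul (by positivity), mul_assoc,
      ← Real.exp_add]
    congr 3
    field_simp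
    ring
  simp_rw [this]
  rw [lintegral_const_mul _ (by fun_prop), lintegral_exp_sq (by positivity),
    ← ENNReal.ofReal_mul (by positivity)]
  congr 1
  field_simp

lemma isProbabilityMeasure_gaussianC {r : ℝ} (hr : 0 < r) :
    IsProbabilityMeasure (gaussianC r) := by
  constructor
  have := lintegral_exp_gaussianC hr (a := 0) (by norm_num)
  simpa using this

instance (t : WeightSequence) (n : ℕ) : IsProbabilityMeasure (gaussianC (t.val n)) :=
  isProbabilityMeasure_gaussianC (t.pos n)

instance (t : WeightSequence) : IsProbabilityMeasure (gaussianProd t) := by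
  unfold gaussianProd; infer_instance

instance : TopologicalSpace.SeparableSpace Ell2 := by
  have b : HilbertBasis ℕ ℂ Ell2 := HilbertBasis.ofRepr (LinearIsometryEquiv.refl ℂ Ell2)
  have h := b.dense_span
  have hs := ((Set.countable_range b).isSeparable.span (R := ℂ)).closure
  rw [← Submodule.topologicalClosure_coe, h] at hs
  exact TopologicalSpace.isSeparable_univ_iff.mp hs

instance : SecondCountableTopology Ell2 := UniformSpace.secondCountable_of_separable Ell2

lemma measurable_coord (n : ℕ) : Measurable fun z : Ell2 => z n :=
  ((lp.evalCLM ℂ (fun _ : ℕ => ℂ) 2 n).continuous).measurable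

lemma measurableEmbedding_coe : MeasurableEmbedding fun (z : Ell2) (n : ℕ) => z n := by
  refine Measurable.measurableEmbedding (measurable_pi_lambda _ measurable_coord) ?_
  intro z w h
  exact lp.ext h

lemma lintegral_sq_gaussianC {r : ℝ} (hr : 0 < r) :
    ∫⁻ z : ℂ, ENNReal.ofReal (‖z‖ ^ 2) ∂(gaussianC r) ≤ ENNReal.ofReal (4 * r) := by
  calc ∫⁻ z : ℂ, ENNReal.ofReal (‖z‖ ^ 2) ∂(gaussianC r)
      ≤ ∫⁻ z : ℂ, ENNReal.ofReal (2 * r) *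
          ENNReal.ofReal (Real.exp (1 / 2 * (‖z‖ ^ 2 / r))) ∂(gaussianC r) := by
        refine lintegral_mono fun z => ?_
        rw [← ENNReal.ofReal_mul (by positivity)]
        refine ENNReal.ofReal_le_ofReal ?_
        have := Real.add_one_le_exp (1 / 2 * (‖z‖ ^ 2 / r))
        have h2 : ‖z‖ ^ 2 = 2 * r * (1 / 2 * (‖z‖ ^ 2 / r)) := by field_simp
        calc ‖z‖ ^ 2 = 2 * r * (1 / 2 * (‖z‖ ^ 2 / r)) := h2
          _ ≤ _ := by gcongr; linarith
    _ = ENNReal.ofReal (4 * r) := by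
        rw [lintegral_const_mul _ (by fun_prop), lintegral_exp_gaussianC hr (by norm_num),
          ← ENNReal.ofReal_mul (by positivity)]
        congr 1; norm_num; ring

lemma ae_mem_range_gaussianProd (t : WeightSequence) :
    ∀ᵐ w ∂(gaussianProd t), w ∈ Set.range fun (z : Ell2) (n : ℕ) => z n := by
  have hint : ∫⁻ w, ∑' n, ENNReal.ofReal (‖w n‖ ^ 2) ∂(gaussianProd t) ≠ ∞ := by
    rw [lintegral_tsum fun n => Measurable.aemeasurable (by fun_prop)]
    have hn : ∀ n, ∫⁻ w, ENNReal.ofReal (‖w n‖ ^ 2) ∂(gaussianProd t)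
        ≤ ENNReal.ofReal (4 * t.val n) := by
      intro n
      have hm := Measure.infinitePi_map_eval (fun n => gaussianC (t.val n)) n
      have := lintegral_sq_gaussianC (t.pos n)
      rwa [← hm, lintegral_map (by fun_prop) (by fun_prop)] at this
    refine ne_top_of_le_ne_top ?_ (ENNReal.tsum_le_tsum hn)
    exact (t.summable.mul_left 4).tsum_ofReal_ne_top
  filter_upwards [ae_lt_top (by fun_prop) hint] with w hw
  have hs : Summable fun n => ‖w n‖ ^ 2 := by
    have := ENNReal.summable_toReal hw.ne
    simpa [ENNReal.toReal_ofReal] using this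
  have hmem : Memℓp (E := fun _ : ℕ => ℂ) w 2 := by
    refine memℓp_gen ?_
    simpa using hs
  exact ⟨⟨w, hmem⟩, rfl⟩

lemma map_gaussian (t : WeightSequence) :
    (gaussian t).map (fun (z : Ell2) (n : ℕ) => z n) = gaussianProd t := by
  rw [gaussian, measurableEmbedding_coe.map_comap]
  exact Measure.restrict_eq_self_of_ae_mem (ae_mem_range_gaussianProd t)

instance (t : WeightSequence) : IsProbabilityMeasure (gaussian t) := by
  have h := map_gaussian t
  have : IsProbabilityMeasure ((gaussian t).map fun (z : Ell2) (n : ℕ) => z n) := by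
    rw [h]; infer_instance
  exact (Measure.isProbabilityMeasure_map_iff
    measurableEmbedding_coe.measurable.aemeasurable).mp this

lemma map_coord_gaussian (t : WeightSequence) (n : ℕ) :
    (gaussian t).map (fun z : Ell2 => z n) = gaussianC (t.val n) := by
  have h : (fun z : Ell2 => z n) = (fun w : ℕ → ℂ => w n) ∘ fun (z : Ell2) (n : ℕ) => z n := rfl
  rw [h, ← Measure.map_map (by fun_prop) measurableEmbedding_coe.measurable, map_gaussian]
  exact Measure.infinitePi_map_eval (fun n => gaussianC (t.val n)) n

lemma memLp_coord (t : WeightSequence) (n : ℕ) (m : ℕ) :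
    MemLp (fun z : Ell2 => z n) m (gaussian t) := by
  have hr := t.pos n
  have key : MemLp (fun z : ℂ => z) ((2 * (m + 1) : ℕ) : ℝ≥0∞) (gaussianC (t.val n)) := by
    refine ⟨by fun_prop, ?_⟩
    rw [eLpNorm_lt_top_iff_lintegral_rpow_enorm_lt_top (by simp)
      (ENNReal.natCast_ne_top _)]
    have hb : ∀ z : ℂ, ‖z‖ₑ ^ (((2 * (m + 1) : ℕ) : ℝ≥0∞).toReal) ≤
        ENNReal.ofReal ((2 * t.val n) ^ (m + 1) * (m + 1).factorial) *
          ENNReal.ofReal (Real.exp (1 / 2 * (‖z‖ ^ 2 / t.val n))) := by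
      intro z
      rw [ENNReal.toReal_natCast, ENNReal.rpow_natCast, ← ofReal_norm,
        ← ENNReal.ofReal_pow (norm_nonneg _), ← ENNReal.ofReal_mul (by positivity)]
      refine ENNReal.ofReal_le_ofReal ?_
      have h := Real.pow_div_factorial_le_exp (1 / 2 * (‖z‖ ^ 2 / t.val n)) (by positivity) (m + 1)
      rw [div_le_iff₀ (by positivity)] at h
      calc ‖z‖ ^ (2 * (m + 1))
          = (2 * t.val n) ^ (m + 1) * (1 / 2 * (‖z‖ ^ 2 / t.val n)) ^ (m + 1) := by
            rw [← mul_pow, pow_mul]; congr 1; field_simp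
        _ ≤ (2 * t.val n) ^ (m + 1) *
            (Real.exp (1 / 2 * (‖z‖ ^ 2 / t.val n)) * (m + 1).factorial) := by gcongr
        _ = _ := by ring
    refine lt_of_le_of_lt (lintegral_mono hb) ?_
    rw [lintegral_const_mul _ (by fun_prop), lintegral_exp_gaussianC hr (by norm_num)]
    exact ENNReal.mul_lt_top ENNReal.ofReal_lt_top ENNReal.ofReal_lt_top
  rw [← map_coord_gaussian] at key
  have h2 := (memLp_map_measure_iff (by fun_prop) (measurable_coord n).aemeasurable).mp key
  refine h2.mono_exponent ?_
  exact_mod_cast (by omega : m ≤ 2 * (m + 1))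

/-- The value `p(w)` of a polynomial in the variables `w_0, w_1, …` at a point of `ℓ²`. -/
def evalPoly (p : MvPolynomial ℕ ℂ) (w : Ell2) : ℂ :=
  MvPolynomial.eval (fun n => w n) p

lemma memLp_evalPoly (t : WeightSequence) (p : MvPolynomial ℕ ℂ) (m : ℕ) :
    MemLp (evalPoly p) m (gaussian t) := by
  induction p using MvPolynomial.induction_on generalizing m with
  | C a =>
    have h : evalPoly (MvPolynomial.C a) = fun _ => a := by funext w; simp [evalPoly]
    rw [h]
    exact memLp_const a
  | add p q hp hq =>
    have h : evalPoly (p + q) = evalPoly p + evalPoly q := by funext w; simp [evalPoly]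
    rw [h]
    exact (hp m).add (hq m)
  | mul_X p n hp =>
    have h1 : MemLp (evalPoly p) ((2 * (m + 1) : ℕ) : ℝ≥0∞) (gaussian t) := hp _
    have h2 : MemLp (fun z : Ell2 => z n) ((2 * (m + 1) : ℕ) : ℝ≥0∞) (gaussian t) :=
      memLp_coord t n _
    have : ENNReal.HolderTriple ((2 * (m + 1) : ℕ) : ℝ≥0∞) ((2 * (m + 1) : ℕ) : ℝ≥0∞)
        ((m + 1 : ℕ) : ℝ≥0∞) := by
      constructor
      rw [Nat.cast_mul, ENNReal.mul_inv (by simp) (by simp), ← add_mul, Nat.cast_ofNat,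
        ENNReal.inv_two_add_inv_two, one_mul]
    have h3 : MemLp (evalPoly p * fun z : Ell2 => z n) ((m + 1 : ℕ) : ℝ≥0∞) (gaussian t) :=
      h2.mul h1
    have h : evalPoly (p * MvPolynomial.X n) = evalPoly p * fun z : Ell2 => z n := by
      funext w; simp [evalPoly]
    rw [h]
    exact h3.mono_exponent (by exact_mod_cast Nat.le_succ m)

/-! ### The Fock-Bargmann space and Toeplitz operators -/

/-- The analytic polynomial `p` as an element of `L²(ℓ², μ_t)`. -/
def polyLp (t : WeightSequence) (p : MvPolynomial ℕ ℂ) : Lp ℂ 2 (gaussian t) :=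
  MemLp.toLp (evalPoly p) (by exact_mod_cast memLp_evalPoly t p 2)

/-- The Fock-Bargmann space `F_t²(ℓ²)`: the closure in `L²(ℓ², μ_t)` of the space of analytic
polynomials, that is, of the span of the monomials `z^α`. -/
def fockSpace (t : WeightSequence) : Submodule ℂ (Lp ℂ 2 (gaussian t)) :=
  (Submodule.span ℂ (Set.range (polyLp t))).topologicalClosure

instance (t : WeightSequence) : CompleteSpace (fockSpace t) :=
  Submodule.topologicalClosure.completeSpace _

/-- The Fock-Bargmann space as a Hilbert space. -/
abbrev Fock (t : WeightSequence) : Type := fockSpace t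

/-- An analytic polynomial as an element of the Fock-Bargmann space. -/
def polyFock (t : WeightSequence) (p : MvPolynomial ℕ ℂ) : Fock t :=
  ⟨polyLp t p, Submodule.le_topologicalClosure _ (Submodule.subset_span ⟨p, rfl⟩)⟩

/-- Multiplication by the symbol `φ ∈ L^∞(ℓ², μ_t)` as a bounded operator on `L²(ℓ², μ_t)`. -/
def mulOp (t : WeightSequence) (φ : Lp ℂ ∞ (gaussian t)) :
    Lp ℂ 2 (gaussian t) →L[ℂ] Lp ℂ 2 (gaussian t) :=
  (ContinuousLinearMap.mul ℂ ℂ).holderL (gaussian t) ∞ 2 2 φ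

/-- The Toeplitz operator `T_φ g = P (φ g)` on the Fock-Bargmann space, where `P` is the orthogonal
projection of `L²(ℓ², μ_t)` onto it. -/
def toeplitz (t : WeightSequence) (φ : Lp ℂ ∞ (gaussian t)) : Fock t →L[ℂ] Fock t :=
  (fockSpace t).orthogonalProjectionOnto ∘L mulOp t φ ∘L (fockSpace t).subtypeL

/-- The C*-algebra of operators on the Hilbert space `F` that is generated by `S` and the identity:
the operator norm closure of the *-algebra generated by `S`. -/
def cstarGenerated {F : Type*} [NormedAddCommGroup F] [InnerProductSpace ℂ F] [CompleteSpace F]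
    (S : Set (F →L[ℂ] F)) : StarSubalgebra ℂ (F →L[ℂ] F) :=
  (StarAlgebra.adjoin ℂ S).topologicalClosure

/-- The C*-algebra generated by the Toeplitz operators with symbols in `S`. -/
def toeplitzAlgebra (t : WeightSequence) (S : Set (Lp ℂ ∞ (gaussian t))) :
    StarSubalgebra ℂ (Fock t →L[ℂ] Fock t) :=
  cstarGenerated (toeplitz t '' S)

/-! ### The symplectic space -/

/-- The Cameron-Martin space `H_{1/2} = {z ∈ ℓ² : ∑ |z_n|² / t_n < ∞}`. -/
def cameronMartin (t : WeightSequence) : Submodule ℂ Ell2 where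
  carrier := {z | Summable fun n => ‖z n‖ ^ 2 / t.val n}
  zero_mem' := by simp
  add_mem' := by
    intro z w hz hw
    refine Summable.of_nonneg_of_le (fun n => div_nonneg (sq_nonneg _) (t.pos n).le) (fun n => ?_)
      ((hz.add hw).mul_left 2)
    rw [← add_div, mul_div_assoc', lp.coeFn_add, Pi.add_apply]
    have h1 := norm_add_le (z n) (w n)
    have h2 := norm_nonneg (z n + w n)
    have h3 := (t.pos n).le
    gcongr
    nlinarith [sq_nonneg (‖z n‖ - ‖w n‖)]
  smul_mem' := by
    intro c z hz
    refine (hz.mul_left (‖c‖ ^ 2)).congr fun n => ?_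
    rw [lp.coeFn_smul, Pi.smul_apply, norm_smul, mul_pow, mul_div_assoc]

/-- The subspace `H_1 = {z ∈ ℓ² : ∑ |z_n|² / t_n² < ∞}` of `H_{1/2}`. -/
def spaceH1 (t : WeightSequence) : Set Ell2 :=
  {z | Summable fun n => ‖z n‖ ^ 2 / t.val n ^ 2}

/-- The norm `‖z‖_{1/2} = (∑ |z_n|² / t_n)^{1/2}` of the Cameron-Martin space. -/
def halfNorm (t : WeightSequence) (z : Ell2) : ℝ :=
  Real.sqrt (∑' n, ‖z n‖ ^ 2 / t.val n)

/-- The pairing `⟨w, z⟩_{1/2} = ∑ w_n conj(z_n) / t_n`; the series converges absolutely if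
`w, z ∈ H_{1/2}`, and if `w ∈ ℓ²`, `z ∈ H_1`. -/
def halfInner (t : WeightSequence) (w z : Ell2) : ℂ :=
  ∑' n, w n * conj (z n) / (t.val n : ℂ)

/-- The symplectic form `σ_t(z, w) = ∑ Im (z_n conj(w_n)) / t_n` of the Cameron-Martin space. -/
def sympl (t : WeightSequence) (z w : Ell2) : ℝ :=
  ∑' n, (z n * conj (w n)).im / t.val n

/-! ### The Weyl operators -/

/-- The normalized reproducing kernel `k_z(w) = exp (⟨w, z⟩_{1/2} - ‖z‖²_{1/2} / 2)`, `z ∈ H_1`. -/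
def normKernel (t : WeightSequence) (z w : Ell2) : ℂ :=
  Complex.exp (halfInner t w z - (halfNorm t z ^ 2 / 2 : ℝ))

/-- `W` is the family of Weyl operators `W_z`, `z ∈ H_{1/2}`: for `z ∈ H_1` the bounded operator
`W_z` is given on analytic polynomials by `(W_z p)(w) = k_z(w) p(w - z)`, and `z ↦ W_z` is the
extension to `H_{1/2}` that is continuous from `‖·‖_{1/2}` to the strong operator topology. -/
structure IsWeylSystem (t : WeightSequence)
    (W : cameronMartin t → (Fock t →L[ℂ] Fock t)) : Prop where
  apply_poly : ∀ z : cameronMartin t, (z : Ell2) ∈ spaceH1 t → ∀ p : MvPolynomial ℕ ℂ,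
    ((W z (polyFock t p) : Lp ℂ 2 (gaussian t)) : Ell2 → ℂ) =ᵐ[gaussian t]
      fun w => normKernel t z w * evalPoly p (w - z)
  strongly_continuous : ∀ (z : cameronMartin t) (f : Fock t), ∀ ε > 0, ∃ δ > 0,
    ∀ z' : cameronMartin t, halfNorm t (z' - z : cameronMartin t) < δ → ‖W z' f - W z f‖ < ε

/-! ### Resolvents of the field operators -/

/-- `h = A f`, where `A` is the (in general unbounded) operator for which `i A` is the infinitesimal
generator of the one-parameter group `U`: the vector `f` is in the domain of `A` if and only if
`(U_s f - f) / s` converges as `s → 0`, and then the limit is `i A f`. -/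
def IsGeneratorValue {F : Type*} [NormedAddCommGroup F] [NormedSpace ℂ F]
    (U : ℝ → (F →L[ℂ] F)) (f h : F) : Prop :=
  Tendsto (fun s : ℝ => (s : ℂ)⁻¹ • (U s f - f)) (𝓝[≠] 0) (𝓝 (Complex.I • h))

/-- The bounded operator `R` is the resolvent `(A - i lam)⁻¹`, where `i A` is the infinitesimal
generator of `U`: it maps into the domain of `A` and is a two-sided inverse of `A - i lam`. -/
structure IsResolvent {F : Type*} [NormedAddCommGroup F] [NormedSpace ℂ F]
    (U : ℝ → (F →L[ℂ] F)) (lam : ℂ) (R : F →L[ℂ] F) : Prop where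
  right_inv : ∀ f : F, ∃ h : F, IsGeneratorValue U (R f) h ∧ h - (Complex.I * lam) • R f = f
  left_inv : ∀ f h : F, IsGeneratorValue U f h → R (h - (Complex.I * lam) • f) = f

/-- The one-parameter group `s ↦ W_{sz}`; its generator is `i` times the field operator at `z`. -/
def weylGroup {t : WeightSequence} (W : cameronMartin t → (Fock t →L[ℂ] Fock t))
    (z : cameronMartin t) : ℝ → (Fock t →L[ℂ] Fock t) :=
  fun s => W ((s : ℂ) • z)

/-- The resolvent algebra of `(H_{1/2}, σ_t)` represented on the Fock-Bargmann space: the C*-algebra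
generated by the resolvents `R(lam, z)`, `lam ∈ ℂ \ iℝ`, `z ∈ H_{1/2}`, of the field operators. -/
def resolventAlgebra {t : WeightSequence} (W : cameronMartin t → (Fock t →L[ℂ] Fock t)) :
    StarSubalgebra ℂ (Fock t →L[ℂ] Fock t) :=
  cstarGenerated {R | ∃ (lam : ℂ) (z : cameronMartin t), lam.re ≠ 0 ∧
    IsResolvent (weylGroup W z) lam R}

/-! ### The classical resolvent algebra -/

/-- The coordinate function `w ↦ w_n` as an element of `L²(ℓ², μ_t)`. -/
def coordLp (t : WeightSequence) (n : ℕ) : Lp ℂ 2 (gaussian t) :=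
  MemLp.toLp (fun w : Ell2 => w n) (by exact_mod_cast memLp_coord t n 2)

/-- For `z ∈ H_{1/2}`, the function `w ↦ ⟨w, z⟩_{1/2} = ∑ w_n conj(z_n) / t_n`, which is defined for
almost every `w ∈ ℓ²`, as the limit of the series in `L²(ℓ², μ_t)`. As a function of `z` it is the
continuous extension to `H_{1/2}` of the pointwise defined pairing with `z ∈ H_1`. -/
def halfInnerLp (t : WeightSequence) (z : cameronMartin t) : Lp ℂ 2 (gaussian t) :=
  ∑' n, (conj ((z : Ell2) n) / (t.val n : ℂ)) • coordLp t n

lemma integral_id_gaussianC (r : ℝ) : ∫ z, z ∂(gaussianC r) = 0 := by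
  have h : (gaussianC r).map (fun z => -z) = gaussianC r := by
    unfold gaussianC
    ext s hs
    rw [Measure.map_apply (by fun_prop) hs, withDensity_apply _ (hs.preimage (by fun_prop)),
      withDensity_apply _ hs]
    have := (Measure.measurePreserving_neg (volume : Measure ℂ)).setLIntegral_comp_preimage hs
      (f := fun z => ENNReal.ofReal ((Real.pi * r)⁻¹ * Real.exp (-(‖z‖ ^ 2 / r)))) (by fun_prop)
    simpa using this
  have h2 : ∫ z, z ∂(gaussianC r) = ∫ z, -z ∂(gaussianC r) := by
    conv_lhs => rw [← h]
    rw [integral_map (by fun_prop) (by fun_prop)]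
  rw [integral_neg] at h2
  exact self_eq_neg.mp h2

lemma inner_coordLp (t : WeightSequence) {m n : ℕ} (hmn : m ≠ n) :
    inner ℂ (coordLp t m) (coordLp t n) = 0 := by
  rw [L2.inner_def]
  have hm : coordLp t m =ᵐ[gaussian t] fun w => w m := MemLp.coeFn_toLp _
  have hn : coordLp t n =ᵐ[gaussian t] fun w => w n := MemLp.coeFn_toLp _
  have : ∫ w, inner ℂ (coordLp t m w) (coordLp t n w) ∂(gaussian t)
      = ∫ w : Ell2, w n * conj (w m) ∂(gaussian t) := by
    refine integral_congr_ae ?_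
    filter_upwards [hm, hn] with w h1 h2
    rw [h1, h2]; rfl
  rw [this]
  have h3 : ∫ w : Ell2, w n * conj (w m) ∂(gaussian t)
      = ∫ w : ℕ → ℂ, w n * conj (w m) ∂(gaussianProd t) := by
    rw [← map_gaussian, measurableEmbedding_coe.integral_map]
  rw [h3]
  have hind := (ProbabilityTheory.iIndepFun_infinitePi (P := fun n => gaussianC (t.val n))
    (X := fun _ z => z) (fun _ => measurable_id)).indepFun hmn.symm
  have hind2 := hind.comp (φ := fun z : ℂ => z) (ψ := fun z : ℂ => conj z)
    (by fun_prop) (Complex.continuous_conj.measurable)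
  have h4 := hind2.integral_fun_mul_eq_mul_integral (by
      exact (Measurable.aestronglyMeasurable (by fun_prop))) (by
      exact ((Complex.continuous_conj.measurable.comp (measurable_pi_apply m))).aestronglyMeasurable)
  refine h4.trans ?_
  have h5 : ∫ w : ℕ → ℂ, w n ∂(gaussianProd t) = 0 := by
    have := integral_id_gaussianC (t.val n)
    rw [← Measure.infinitePi_map_eval (fun n => gaussianC (t.val n)) n,
      integral_map (measurable_pi_apply n).aemeasurable (by fun_prop)] at this
    exact this
  exact mul_eq_zero_of_left h5 _

lemma norm_coordLp_sq_le (t : WeightSequence) (n : ℕ) : ‖coordLp t n‖ ^ 2 ≤ 4 * t.val n := by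
  have h := lintegral_sq_gaussianC (t.pos n)
  rw [← map_coord_gaussian, lintegral_map (by fun_prop) (measurable_coord n)] at h
  have h2 := eLpNorm_nnreal_pow_eq_lintegral (p := 2) (μ := gaussian t)
    (f := fun w : Ell2 => w n) (by norm_num)
  rw [coordLp, Lp.norm_toLp, ← ENNReal.toReal_pow]
  refine ENNReal.toReal_le_of_le_ofReal (by linarith [t.pos n]) ?_
  refine le_trans (le_of_eq ?_) h
  norm_num at h2
  rw [h2]
  refine lintegral_congr fun w => ?_
  rw [← ofReal_norm, ENNReal.ofReal_pow (norm_nonneg _)]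

/-- The series that defines `⟨·, z⟩_{1/2}` converges in `L²(ℓ², μ_t)` for `z ∈ H_{1/2}`. -/
lemma summable_halfInnerLp (t : WeightSequence) (z : cameronMartin t) :
    Summable fun n => (conj ((z : Ell2) n) / (t.val n : ℂ)) • coordLp t n := by
  set v : ℕ → Lp ℂ 2 (gaussian t) := fun n => (conj ((z : Ell2) n) / (t.val n : ℂ)) • coordLp t n
  have ho : OrthogonalFamily ℂ (fun n => Submodule.span ℂ {v n})
      fun n => (Submodule.span ℂ {v n}).subtypeₗᵢ := by
    refine OrthogonalFamily.of_pairwise fun m n hmn => ?_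
    refine Submodule.isOrtho_span.mpr ?_
    rintro _ rfl _ rfl
    simp only [v, inner_smul_left, inner_smul_right, inner_coordLp t hmn, mul_zero]
  have key := ho.summable_iff_norm_sq_summable
    fun n => ⟨v n, Submodule.mem_span_singleton_self _⟩
  refine key.mpr ?_
  refine Summable.of_nonneg_of_le (fun n => sq_nonneg _) (fun n => ?_) (z.2.mul_left 4)
  have ht := t.pos n
  change ‖v n‖ ^ 2 ≤ _
  simp only [v, norm_smul, mul_pow, norm_div, RCLike.norm_conj, Complex.norm_real, div_pow,
    Real.norm_eq_abs, sq_abs]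
  calc ‖(z : Ell2) n‖ ^ 2 / t.val n ^ 2 * ‖coordLp t n‖ ^ 2
      ≤ ‖(z : Ell2) n‖ ^ 2 / t.val n ^ 2 * (4 * t.val n) := by
        gcongr; exact norm_coordLp_sq_le t n
    _ = 4 * (‖(z : Ell2) n‖ ^ 2 / t.val n) := by field_simp

/-- For `z ∈ H_1` the function `⟨·, z⟩_{1/2}` is given pointwise by the absolutely convergent
series. -/
lemma halfInnerLp_ae_eq (t : WeightSequence) (z : cameronMartin t) (hz : (z : Ell2) ∈ spaceH1 t) :
    halfInnerLp t z =ᵐ[gaussian t] fun w => halfInner t w z := by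
  have hs := (summable_halfInnerLp t z).hasSum.tendsto_sum_nat
  obtain ⟨φ, hφ, hlim⟩ := (tendstoInMeasure_of_tendsto_Lp hs).exists_seq_tendsto_ae
  have hpart : ∀ N, (((∑ n ∈ Finset.range N,
      (conj ((z : Ell2) n) / (t.val n : ℂ)) • coordLp t n : Lp ℂ 2 (gaussian t))) : Ell2 → ℂ)
      =ᵐ[gaussian t] fun w => ∑ n ∈ Finset.range N, w n * conj ((z : Ell2) n) / (t.val n : ℂ) := by
    intro N
    induction N with
    | zero =>
      simp only [Finset.range_zero, Finset.sum_empty]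
      exact Lp.coeFn_zero ℂ 2 (gaussian t)
    | succ N ih =>
      rw [Finset.sum_range_succ]
      have hc : coordLp t N =ᵐ[gaussian t] fun w => w N := MemLp.coeFn_toLp _
      filter_upwards [Lp.coeFn_add (∑ n ∈ Finset.range N,
        (conj ((z : Ell2) n) / (t.val n : ℂ)) • coordLp t n)
        ((conj ((z : Ell2) N) / (t.val N : ℂ)) • coordLp t N), ih,
        Lp.coeFn_smul (conj ((z : Ell2) N) / (t.val N : ℂ)) (coordLp t N), hc] with w h1 h2 h3 h4
      rw [h1, Pi.add_apply, h2, h3, Pi.smul_apply, h4, Finset.sum_range_succ, smul_eq_mul]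
      ring
  filter_upwards [hlim, ae_all_iff.mpr hpart] with w h1 h2
  have hw : Summable fun n => ‖w n‖ ^ 2 := by simpa using (lp.memℓp w).summable (by norm_num)
  have hsum : Summable fun n => w n * conj ((z : Ell2) n) / (t.val n : ℂ) := by
    refine Summable.of_norm_bounded (hw.add hz) fun n => ?_
    rw [norm_div, norm_mul, RCLike.norm_conj, Complex.norm_real, Real.norm_eq_abs,
      abs_of_pos (t.pos n), mul_div_assoc, ← div_pow]
    have : 0 ≤ ‖(z : Ell2) n‖ / t.val n := div_nonneg (norm_nonneg _) (t.pos n).le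
    nlinarith [sq_nonneg (‖w n‖ - ‖(z : Ell2) n‖ / t.val n), norm_nonneg (w n)]
  have h3 := hsum.hasSum.tendsto_sum_nat.comp hφ.tendsto_atTop
  refine tendsto_nhds_unique h1 (h3.congr fun i => ?_)
  exact (h2 (φ i)).symm

/-- The almost everywhere defined function `w ↦ σ_t(w, z) = Im ⟨w, z⟩_{1/2}` for `z ∈ H_{1/2}`. -/
def symplFun (t : WeightSequence) (z : cameronMartin t) (w : Ell2) : ℝ :=
  ((halfInnerLp t z : Ell2 → ℂ) w).im

/-- `A` is a C*-subalgebra of `L^∞(ℓ², μ_t)`: a norm closed subspace that is stable under pointwise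
products and complex conjugation. -/
structure IsCStarSubalgebra (t : WeightSequence) (A : Set (Lp ℂ ∞ (gaussian t))) : Prop where
  isClosed : IsClosed A
  zero_mem : 0 ∈ A
  add_mem : ∀ f ∈ A, ∀ g ∈ A, f + g ∈ A
  smul_mem : ∀ (c : ℂ), ∀ f ∈ A, c • f ∈ A
  mul_mem : ∀ f ∈ A, ∀ g ∈ A, ∀ h : Lp ℂ ∞ (gaussian t),
    (h =ᵐ[gaussian t] fun w => f w * g w) → h ∈ A
  conj_mem : ∀ f ∈ A, ∀ h : Lp ℂ ∞ (gaussian t),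
    (h =ᵐ[gaussian t] fun w => conj (f w)) → h ∈ A

/-- The classical resolvent functions `(lam - 2 i σ_t(·, z))⁻¹`, `lam ∈ ℂ \ iℝ`, `z ∈ H_{1/2}`. -/
def classicalResolvents (t : WeightSequence) : Set (Lp ℂ ∞ (gaussian t)) :=
  {φ | ∃ (lam : ℂ) (z : cameronMartin t), lam.re ≠ 0 ∧
    φ =ᵐ[gaussian t] fun w => (lam - 2 * Complex.I * (symplFun t z w : ℂ))⁻¹}

/-- The classical resolvent algebra: the C*-subalgebra of `L^∞(ℓ², μ_t)` generated by the classical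
resolvent functions. -/
def classicalResolventAlgebra (t : WeightSequence) : Set (Lp ℂ ∞ (gaussian t)) :=
  ⋂₀ {A | IsCStarSubalgebra t A ∧ classicalResolvents t ⊆ A}

end FockBargmann

end

open FockBargmann

/-!
The operators `e^{‖z‖²/2} T_φ` with the unimodular symbols `φ = e^{2iσ(·, z)}` form the Weyl system
(`weyl`). On the reproducing kernels at finitely supported points (`expFock`), whose span is dense
(`dense_span_expFock`), these operators are computed from the Laplace transform of the Gaussian
measure (`integral_expFun_mul_conj`, `weyl_finVec_expFock`). The formula on polynomials and the Weyl
relations follow for finitely supported `z`, since a polynomial is a limit of combinations of kernels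
that converges pointwise as well as in `L²` (`polynomial_mul_expFun_induction`). They extend to `H_1`
and to `H_{1/2}`, respectively, by strong continuity (`tendsto_weyl_apply`), which rests on the
estimate `‖⟨·, z⟩‖ ≤ 2 ‖z‖` in `L²`. Density of polynomials and of finitely supported points gives
uniqueness.

For `Re μ > 0` the resolvent at `-μ` is `-i ∫₀^∞ e^{-μ s} W_{sz} ds` (`isResolvent_laplaceOp`), and
the other half plane is reached by replacing `z` by `-z`. The inclusion of the algebras comes from an
explicit norm convergent series. With `c = ‖z‖² / 2` the identity
`T_{e^{2isσ(·, z)}} = e^{-c s²} W_{sz}` and Fubini give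
`k! T_{(μ - 2iσ(·, z))^{-(k+1)}} = ∫₀^∞ s^k e^{-μ s} e^{-c s²} W_{sz} ds`
(`factorial_mul_inner_toeplitz_classicalResolventPow`), and expanding `1 = e^{-c s²} ∑ (c s²)ⁿ / n!`
under the integral sign yields
`∫₀^∞ e^{-μ s} W_{sz} ds = ∑ cⁿ (2n)! / n! T_{(μ - 2iσ(·, z))^{-(2n+1)}}`.
The series converges in norm because `0 ≤ 1 - e^{-x} ∑_{n < N} xⁿ / n! ≤ 1` tends to `0` as `N → ∞`
(`tendsto_norm_laplaceOp_sub_toeplitzPartialSum`), and its symbols are powers of a classical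
resolvent function.
-/

noncomputable section

namespace FockBargmann

/-! ### Exponential integrals for the Gaussian measure -/

/-- The Laplace transform of the Gaussian measure on `ℂ`, with independent complex parameters for
`z` and its conjugate. -/
lemma integral_cexp_gaussianC {r : ℝ} (hr : 0 < r) (a b : ℂ) :
    ∫ z, Complex.exp (a * z + b * conj z) ∂(gaussianC r) = Complex.exp (r * a * b) := by
  have hd : (gaussianC r) = volume.withDensity fun z : ℂ =>
      ((Real.toNNReal ((Real.pi * r)⁻¹ * Real.exp (-(‖z‖ ^ 2 / r))) : NNReal) : ℝ≥0∞) := rfl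
  rw [hd, integral_withDensity_eq_integral_smul (by fun_prop),
    ← Complex.volume_preserving_equiv_pi.symm.integral_comp
      Complex.measurableEquivPi.symm.measurableEmbedding]
  have hb : 0 < ((r : ℂ)⁻¹).re := by
    rw [← Complex.ofReal_inv, Complex.ofReal_re]; positivity
  have key := GaussianFourier.integral_cexp_neg_mul_sum_add hb
    (fun i : Fin 2 => if i = 0 then a + b else Complex.I * (a - b))
  have hr0 : (r : ℂ) ≠ 0 := by exact_mod_cast hr.ne'
  have hpi : (Real.pi : ℂ) ≠ 0 := by exact_mod_cast Real.pi_ne_zero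
  have hpt : ∀ p : Fin 2 → ℝ,
      (Real.toNNReal ((Real.pi * r)⁻¹ *
        Real.exp (-(‖Complex.measurableEquivPi.symm p‖ ^ 2 / r)))) •
        Complex.exp (a * Complex.measurableEquivPi.symm p +
          b * conj (Complex.measurableEquivPi.symm p))
      = ((Real.pi * r)⁻¹ : ℂ) * Complex.exp (-(r : ℂ)⁻¹ * ∑ i, (p i : ℂ) ^ 2 +
        ∑ i, (if i = 0 then a + b else Complex.I * (a - b)) * p i) := by
    intro p
    rw [NNReal.smul_def, Real.coe_toNNReal _ (by positivity), Complex.real_smul, Complex.ofReal_mul,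
      mul_assoc, Complex.ofReal_exp, ← Complex.exp_add]
    congr 2
    · push_cast; ring
    · rw [← Complex.normSq_eq_norm_sq, Complex.measurableEquivPi_symm_apply]
      simp only [Fin.sum_univ_two, Fin.isValue, if_true, one_ne_zero, if_false, Complex.normSq_apply]
      simp
      field_simp
      ring
  simp_rw [hpt]
  rw [integral_const_mul, key]
  simp only [Fintype.card_fin, Fin.sum_univ_two, Fin.isValue, if_true, one_ne_zero, if_false]
  rw [Nat.cast_ofNat, div_self two_ne_zero, Complex.cpow_one, mul_pow, Complex.I_sq, ← mul_assoc]
  have h1 : ((Real.pi : ℂ) * r)⁻¹ * (Real.pi / (r : ℂ)⁻¹) = 1 := by field_simp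
  rw [h1, one_mul]
  congr 1
  field_simp
  ring

/-- The coordinates of `ℓ²` are independent under the Gaussian measure. -/
lemma iIndepFun_coord (t : WeightSequence) :
    ProbabilityTheory.iIndepFun (fun (n : ℕ) (w : Ell2) => w n) (gaussian t) := by
  rw [ProbabilityTheory.iIndepFun_iff_map_fun_eq_infinitePi_map measurable_coord]
  simp_rw [map_coord_gaussian]
  exact map_gaussian t

/-! ### Functions of exponential type in finitely many coordinates -/

/-- The exponential weight `exp (c (|w_0| + … + |w_{M-1}|))`. -/
def expWeight (M : ℕ) (c : ℝ) (w : Ell2) : ℝ := Real.exp (c * ∑ n ∈ Finset.range M, ‖w n‖)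

lemma expWeight_pos (M : ℕ) (c : ℝ) (w : Ell2) : 0 < expWeight M c w := Real.exp_pos _

lemma measurable_expWeight (M : ℕ) (c : ℝ) : Measurable (expWeight M c) := by
  exact ((Finset.measurable_fun_sum _ fun n _ => (measurable_coord n).norm).const_mul c).exp

lemma expWeight_mono {M M' : ℕ} {c c' : ℝ} (hM : M ≤ M') (hc0 : 0 ≤ c) (hc : c ≤ c') (w : Ell2) :
    expWeight M c w ≤ expWeight M' c' w := by
  refine Real.exp_le_exp.mpr (mul_le_mul hc ?_ (by positivity) (hc0.trans hc))
  exact Finset.sum_le_sum_of_subset_of_nonneg (Finset.range_mono hM) fun _ _ _ => norm_nonneg _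

lemma expWeight_mul (M : ℕ) (c c' : ℝ) (w : Ell2) :
    expWeight M c w * expWeight M c' w = expWeight M (c + c') w := by
  rw [expWeight, expWeight, ← Real.exp_add, ← add_mul]; rfl

lemma memLp_expWeight (t : WeightSequence) (M : ℕ) (c : ℝ) :
    MemLp (expWeight M c) 2 (gaussian t) := by
  refine ⟨(measurable_expWeight M c).aestronglyMeasurable, ?_⟩
  rw [eLpNorm_lt_top_iff_lintegral_rpow_enorm_lt_top (by simp) (by simp)]
  have hprod : ∀ w : Ell2, ‖expWeight M c w‖ₑ ^ (2 : ℝ≥0∞).toReal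
      = ∏ n ∈ Finset.range M, ENNReal.ofReal (Real.exp (2 * c * ‖w n‖)) := by
    intro w
    rw [← ENNReal.ofReal_prod_of_nonneg fun _ _ => (Real.exp_pos _).le, ← Real.exp_sum,
      ← Finset.mul_sum, Real.enorm_of_nonneg (expWeight_pos M c w).le, ENNReal.toReal_ofNat,
      ← Nat.cast_ofNat (R := ℝ), ENNReal.rpow_natCast, ← ENNReal.ofReal_pow (expWeight_pos M c w).le,
      expWeight, ← Real.exp_nat_mul]
    congr 2
    push_cast; ring
  simp_rw [hprod]
  have hind := (iIndepFun_coord t).comp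
    (fun n (z : ℂ) => ENNReal.ofReal (Real.exp (2 * c * ‖z‖))) (fun n => by fun_prop)
  rw [ProbabilityTheory.lintegral_prod_eq_prod_lintegral_of_indepFun _
    (fun n (w : Ell2) => ENNReal.ofReal (Real.exp (2 * c * ‖w n‖))) hind
    (fun n => ((measurable_coord n).norm.const_mul (2 * c)).exp.ennreal_ofReal)]
  refine ENNReal.prod_lt_top fun n _ => ?_
  have hr := t.pos n
  have hmap : ∫⁻ w : Ell2, ENNReal.ofReal (Real.exp (2 * c * ‖w n‖)) ∂(gaussian t)
      = ∫⁻ z, ENNReal.ofReal (Real.exp (2 * c * ‖z‖)) ∂(gaussianC (t.val n)) := by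
    rw [← map_coord_gaussian, lintegral_map (by fun_prop) (measurable_coord n)]
  rw [hmap]
  have hb : ∀ z : ℂ, ENNReal.ofReal (Real.exp (2 * c * ‖z‖)) ≤
      ENNReal.ofReal (Real.exp (2 * c ^ 2 * t.val n)) *
        ENNReal.ofReal (Real.exp (1 / 2 * (‖z‖ ^ 2 / t.val n))) := by
    intro z
    rw [← ENNReal.ofReal_mul (Real.exp_pos _).le, ← Real.exp_add]
    refine ENNReal.ofReal_le_ofReal (Real.exp_le_exp.mpr ?_)
    -- complete the square: `2cx ≤ 2c²r + x² / (2r)`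
    have h : 2 * c ^ 2 * t.val n + 1 / 2 * (‖z‖ ^ 2 / t.val n) - 2 * c * ‖z‖
        = (2 * c * t.val n - ‖z‖) ^ 2 / (2 * t.val n) := by field_simp; ring
    have : 0 ≤ (2 * c * t.val n - ‖z‖) ^ 2 / (2 * t.val n) := by positivity
    linarith
  refine lt_of_le_of_lt (lintegral_mono hb) ?_
  rw [lintegral_const_mul _ (by fun_prop), lintegral_exp_gaussianC hr (by norm_num)]
  exact ENNReal.mul_lt_top ENNReal.ofReal_lt_top ENNReal.ofReal_lt_top

/-- A family of functions on `ℓ²` that is bounded, uniformly in the index, by a multiple of an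
exponential weight in finitely many coordinates. -/
def UnifExpType {ι : Type*} (F : ι → Ell2 → ℂ) : Prop :=
  ∃ (M : ℕ) (c C : ℝ), 0 ≤ c ∧ ∀ j w, ‖F j w‖ ≤ C * expWeight M c w

namespace UnifExpType

variable {ι ι' : Type*} {F G : ι → Ell2 → ℂ}

lemma mul (hF : UnifExpType F) (hG : UnifExpType G) : UnifExpType fun j w => F j w * G j w := by
  obtain ⟨M, c, C, hc, h⟩ := hF
  obtain ⟨M', c', C', hc', h'⟩ := hG
  refine ⟨max M M', c + c', |C| * |C'|, by positivity, fun j w => ?_⟩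
  have h1 := expWeight_mono (le_max_left M M') hc le_rfl w
  have h2 := expWeight_mono (le_max_right M M') hc' le_rfl w
  have p1 := expWeight_pos M c w
  have p2 := expWeight_pos M' c' w
  rw [norm_mul, ← expWeight_mul]
  calc ‖F j w‖ * ‖G j w‖ ≤ (|C| * expWeight M c w) * (|C'| * expWeight M' c' w) := by
        refine mul_le_mul ((h j w).trans ?_) ((h' j w).trans ?_) (norm_nonneg _) (by positivity)
        · gcongr; exact le_abs_self C
        · gcongr; exact le_abs_self C'
    _ ≤ (|C| * expWeight (max M M') c w) * (|C'| * expWeight (max M M') c' w) := by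
        have := expWeight_pos (max M M') c w
        gcongr
    _ = _ := by ring

lemma add (hF : UnifExpType F) (hG : UnifExpType G) : UnifExpType fun j w => F j w + G j w := by
  obtain ⟨M, c, C, hc, h⟩ := hF
  obtain ⟨M', c', C', hc', h'⟩ := hG
  refine ⟨max M M', max c c', |C| + |C'|, hc.trans (le_max_left _ _), fun j w => ?_⟩
  have h1 := expWeight_mono (le_max_left M M') hc (le_max_left c c') w
  have h2 := expWeight_mono (le_max_right M M') hc' (le_max_right c c') w
  have p1 := expWeight_pos M c w
  have p2 := expWeight_pos M' c' w
  calc ‖F j w + G j w‖ ≤ ‖F j w‖ + ‖G j w‖ := norm_add_le _ _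
    _ ≤ |C| * expWeight M c w + |C'| * expWeight M' c' w := by
        refine add_le_add ((h j w).trans ?_) ((h' j w).trans ?_)
        · gcongr; exact le_abs_self C
        · gcongr; exact le_abs_self C'
    _ ≤ _ := by rw [add_mul]; gcongr

lemma mono (hF : UnifExpType F) {H : ι' → Ell2 → ℂ} (e : ι' → ι)
    (h : ∀ j w, ‖H j w‖ ≤ ‖F (e j) w‖) : UnifExpType H := by
  obtain ⟨M, c, C, hc, h'⟩ := hF
  exact ⟨M, c, C, hc, fun j w => (h j w).trans (h' (e j) w)⟩

lemma memLp (t : WeightSequence) (hF : UnifExpType F) (j : ι) (hm : Measurable (F j)) :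
    MemLp (F j) 2 (gaussian t) := by
  obtain ⟨M, c, C, hc, h⟩ := hF
  refine ((memLp_expWeight t M c).const_mul C).mono' hm.aestronglyMeasurable ?_
  exact ae_of_all _ (h j)

end UnifExpType

lemma unifExpType_const {ι : Type*} (a : ℂ) : UnifExpType fun (_ : ι) (_ : Ell2) => a :=
  ⟨0, 0, ‖a‖, le_rfl, fun j w => by simp [expWeight]⟩

lemma unifExpType_coord {ι : Type*} (n : ℕ) : UnifExpType fun (_ : ι) (w : Ell2) => w n := by
  refine ⟨n + 1, 1, 1, zero_le_one, fun j w => ?_⟩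
  rw [one_mul, expWeight, one_mul]
  have h1 : ‖w n‖ ≤ ∑ k ∈ Finset.range (n + 1), ‖w k‖ :=
    Finset.single_le_sum (f := fun k => ‖w k‖) (fun _ _ => norm_nonneg _)
      (Finset.self_mem_range_succ n)
  linarith [Real.add_one_le_exp (∑ k ∈ Finset.range (n + 1), ‖w k‖)]

/-- The weight `exp (c |w_n|)`. -/
lemma unifExpType_exp_norm_coord {ι : Type*} {c : ℝ} (hc : 0 ≤ c) (n : ℕ) :
    UnifExpType fun (_ : ι) (w : Ell2) => (Real.exp (c * ‖w n‖) : ℂ) := by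
  refine ⟨n + 1, c, 1, hc, fun j w => ?_⟩
  rw [one_mul, expWeight, Complex.norm_real, Real.norm_of_nonneg (Real.exp_pos _).le]
  exact Real.exp_le_exp.mpr (mul_le_mul_of_nonneg_left (Finset.single_le_sum (f := fun k => ‖w k‖)
    (fun _ _ => norm_nonneg _) (Finset.self_mem_range_succ n)) hc)

lemma evalPoly_C (a : ℂ) : evalPoly (MvPolynomial.C a) = fun _ => a := by
  funext w; simp [evalPoly]

lemma evalPoly_add (p q : MvPolynomial ℕ ℂ) :
    evalPoly (p + q) = fun w => evalPoly p w + evalPoly q w := by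
  funext w; simp [evalPoly]

lemma evalPoly_mul_X (p : MvPolynomial ℕ ℂ) (n : ℕ) :
    evalPoly (p * MvPolynomial.X n) = fun w => evalPoly p w * w n := by
  funext w; simp [evalPoly]

lemma unifExpType_evalPoly {ι : Type*} (p : MvPolynomial ℕ ℂ) :
    UnifExpType fun (_ : ι) => evalPoly p := by
  induction p using MvPolynomial.induction_on with
  | C a => exact evalPoly_C a ▸ unifExpType_const (ι := ι) a
  | add p q hp hq => exact evalPoly_add p q ▸ hp.add hq
  | mul_X p n hp => exact evalPoly_mul_X p n ▸ hp.mul (unifExpType_coord n)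

lemma measurable_evalPoly (p : MvPolynomial ℕ ℂ) : Measurable (evalPoly p) := by
  induction p using MvPolynomial.induction_on with
  | C a => exact evalPoly_C a ▸ measurable_const
  | add p q hp hq => exact evalPoly_add p q ▸ hp.add hq
  | mul_X p n hp => exact evalPoly_mul_X p n ▸ hp.mul (measurable_coord n)

/-! ### Exponentials of finitely many coordinates -/

/-- The linear form `w ↦ ∑ α_n w_n`. -/
def linForm (α : ℕ →₀ ℂ) (w : Ell2) : ℂ := Finsupp.linearCombination ℂ (fun n => (w n : ℂ)) α

/-- The exponential `w ↦ exp (∑ α_n w_n)`; these functions are the reproducing kernels at the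
finitely supported points. -/
def expFun (α : ℕ →₀ ℂ) (w : Ell2) : ℂ := Complex.exp (linForm α w)

lemma linForm_add (α β : ℕ →₀ ℂ) (w : Ell2) : linForm (α + β) w = linForm α w + linForm β w :=
  map_add _ _ _

lemma linForm_neg (α : ℕ →₀ ℂ) (w : Ell2) : linForm (-α) w = -linForm α w :=
  map_neg _ _

lemma linForm_single (n : ℕ) (c : ℂ) (w : Ell2) : linForm (Finsupp.single n c) w = c * w n := by
  simp [linForm]

lemma linForm_eq_sum (α : ℕ →₀ ℂ) {s : Finset ℕ} (hs : α.support ⊆ s) (w : Ell2) :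
    linForm α w = ∑ n ∈ s, α n * w n := by
  rw [linForm, Finsupp.linearCombination_apply, Finsupp.sum_of_support_subset _ hs _ (by simp)]
  rfl

lemma linForm_sub_right (α : ℕ →₀ ℂ) (v w : Ell2) :
    linForm α (w - v) = linForm α w - linForm α v := by
  simp only [linForm_eq_sum α subset_rfl, lp.coeFn_sub, Pi.sub_apply, mul_sub,
    Finset.sum_sub_distrib]

lemma linForm_add_right (α : ℕ →₀ ℂ) (v w : Ell2) :
    linForm α (w + v) = linForm α w + linForm α v := by
  simp only [linForm_eq_sum α subset_rfl, lp.coeFn_add, Pi.add_apply, mul_add,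
    Finset.sum_add_distrib]

lemma measurable_linForm (α : ℕ →₀ ℂ) : Measurable (linForm α) := by
  rw [funext (linForm_eq_sum α subset_rfl)]
  exact Finset.measurable_fun_sum _ fun n _ => (measurable_coord n).const_mul (α n)

lemma measurable_expFun (α : ℕ →₀ ℂ) : Measurable (expFun α) :=
  (measurable_linForm α).cexp

lemma expFun_add (α β : ℕ →₀ ℂ) (w : Ell2) : expFun (α + β) w = expFun α w * expFun β w := by
  rw [expFun, linForm_add, Complex.exp_add]; rfl

lemma expFun_zero : expFun 0 = fun _ => 1 := by
  funext w; simp [expFun, linForm]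

lemma unifExpType_expFun {ι : Type*} (α : ℕ →₀ ℂ) : UnifExpType fun (_ : ι) => expFun α := by
  induction α using Finsupp.induction_linear with
  | zero => exact expFun_zero ▸ unifExpType_const (ι := ι) 1
  | add α β h1 h2 => simpa only [← expFun_add] using h1.mul h2
  | single n c =>
    refine (unifExpType_exp_norm_coord (ι := ι) (norm_nonneg c) n).mono id fun j w => ?_
    rw [expFun, linForm_single, Complex.norm_real, Real.norm_of_nonneg (Real.exp_pos _).le,
      ← norm_mul]
    exact Complex.norm_exp_le_exp_norm _

lemma memLp_expFun (t : WeightSequence) (α : ℕ →₀ ℂ) : MemLp (expFun α) 2 (gaussian t) :=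
  (unifExpType_expFun (ι := Unit) α).memLp t () (measurable_expFun α)

/-- The finitely supported point with coordinates `t_n conj(α_n)`, at which `expFun α` is the
reproducing kernel. -/
def finVec (t : WeightSequence) (α : ℕ →₀ ℂ) : cameronMartin t :=
  ⟨⟨fun n => t.val n * conj (α n), memℓp_gen <| by
    refine summable_of_ne_finset_zero (s := α.support) fun n hn => ?_
    simp [Finsupp.notMem_support_iff.mp hn]⟩, by
    refine summable_of_ne_finset_zero (s := α.support) fun n hn => ?_
    simp [Finsupp.notMem_support_iff.mp hn]⟩

@[simp]
lemma finVec_apply (t : WeightSequence) (α : ℕ →₀ ℂ) (n : ℕ) :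
    (finVec t α : Ell2) n = t.val n * conj (α n) := rfl

lemma finVec_add (t : WeightSequence) (α β : ℕ →₀ ℂ) :
    finVec t (α + β) = finVec t α + finVec t β := by
  refine Subtype.ext (lp.ext (funext fun n => ?_))
  simp [mul_add]

lemma finVec_neg (t : WeightSequence) (α : ℕ →₀ ℂ) : finVec t (-α) = -finVec t α := by
  refine Subtype.ext (lp.ext (funext fun n => ?_))
  simp

/-- The reproducing kernels of the Fock-Bargmann space have the inner products
`⟪K_b, K_a⟫ = K_a(b)`. -/
lemma integral_expFun_mul_conj (t : WeightSequence) (α β : ℕ →₀ ℂ) :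
    ∫ w, expFun α w * conj (expFun β w) ∂(gaussian t)
      = Complex.exp (linForm α (finVec t β)) := by
  classical
  set s := α.support ∪ β.support
  have hα : α.support ⊆ s := Finset.subset_union_left
  have hβ : β.support ⊆ s := Finset.subset_union_right
  have hpt : ∀ w : Ell2, expFun α w * conj (expFun β w)
      = ∏ n : s, Complex.exp (α n * w n + conj (β n) * conj (w n)) := by
    intro w
    rw [← Complex.exp_sum, expFun, expFun, ← Complex.exp_conj, ← Complex.exp_add,
      linForm_eq_sum α hα, linForm_eq_sum β hβ, map_sum, ← Finset.sum_add_distrib,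
      ← Finset.sum_coe_sort]
    simp
  simp_rw [hpt]
  have hind := (iIndepFun_coord t).precomp (g := fun n : s => (n : ℕ)) Subtype.val_injective
  have hcm : Measurable fun z : ℂ => conj z := Complex.continuous_conj.measurable
  refine (hind.integral_fun_prod_comp
    (f := fun (n : s) (z : ℂ) => Complex.exp (α n * z + conj (β n) * conj z))
    (fun n => (measurable_coord n).aemeasurable)
    (fun n => Measurable.aestronglyMeasurable (by fun_prop))).trans ?_
  rw [linForm_eq_sum α hα, Complex.exp_sum, ← Finset.prod_coe_sort s]
  refine Finset.prod_congr rfl fun n _ => ?_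
  have := integral_cexp_gaussianC (t.pos n) (α n) (conj (β n))
  rw [← map_coord_gaussian, integral_map (measurable_coord n).aemeasurable
    (Measurable.aestronglyMeasurable (by fun_prop))] at this
  rw [this, finVec_apply]
  congr 1
  ring

/-! ### Polynomials and exponentials in the Fock-Bargmann space -/

lemma norm_sq_eq_integral_norm_sq {α : Type*} {m : MeasurableSpace α} {μ : Measure α}
    (f : Lp ℂ 2 μ) : ‖f‖ ^ 2 = ∫ x, ‖f x‖ ^ 2 ∂μ := by
  have h : ((‖f‖ ^ 2 : ℝ) : ℂ) = ((∫ x, ‖f x‖ ^ 2 ∂μ : ℝ) : ℂ) := by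
    rw [← integral_complex_ofReal, Complex.ofReal_pow]
    refine (inner_self_eq_norm_sq_to_K (𝕜 := ℂ) f).symm.trans ?_
    rw [L2.inner_def]
    refine integral_congr_ae (ae_of_all _ fun x => ?_)
    exact (inner_self_eq_norm_sq_to_K (𝕜 := ℂ) (f x)).trans (by simp)
  exact_mod_cast h

/-- Dominated convergence in `L²(ℓ², μ_t)` for families of uniform exponential type. -/
lemma tendsto_Lp_of_unifExpType (t : WeightSequence) {F : ℕ → Ell2 → ℂ} {G : Ell2 → ℂ}
    (hF : UnifExpType F) {f : ℕ → Lp ℂ 2 (gaussian t)} {g : Lp ℂ 2 (gaussian t)}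
    (hf : ∀ j, f j =ᵐ[gaussian t] F j) (hg : g =ᵐ[gaussian t] G)
    (hlim : ∀ w, Tendsto (fun j => F j w) atTop (𝓝 (G w))) : Tendsto f atTop (𝓝 g) := by
  obtain ⟨M, c, C, hc, hb⟩ := hF
  have hG : ∀ w, ‖G w‖ ≤ C * expWeight M c w := fun w =>
    le_of_tendsto (hlim w).norm (Eventually.of_forall fun j => hb j w)
  have hFm : ∀ j, AEStronglyMeasurable (F j) (gaussian t) := fun j =>
    (Lp.aestronglyMeasurable (f j)).congr (hf j)
  have hGm : AEStronglyMeasurable G (gaussian t) := (Lp.aestronglyMeasurable g).congr hg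
  have h0 : Tendsto (fun j => ∫ w, ‖F j w - G w‖ ^ 2 ∂(gaussian t)) atTop
      (𝓝 (∫ _, (0 : ℝ) ∂(gaussian t))) := by
    refine tendsto_integral_of_dominated_convergence
      (fun w => (2 * C * expWeight M c w) ^ 2) (fun j => ?_) ?_ (fun j => ?_) ?_
    · exact (((hFm j).sub hGm).norm.pow 2)
    · exact ((memLp_expWeight t M c).const_mul (2 * C)).integrable_sq
    · refine ae_of_all _ fun w => ?_
      rw [Real.norm_of_nonneg (by positivity)]
      refine pow_le_pow_left₀ (norm_nonneg _) ((norm_sub_le _ _).trans ?_) 2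
      linarith [hb j w, hG w]
    · refine ae_of_all _ fun w => ?_
      have := ((hlim w).sub_const (G w)).norm.pow 2
      simpa using this
  rw [integral_zero] at h0
  rw [tendsto_iff_norm_sub_tendsto_zero]
  have h1 : ∀ j, ‖f j - g‖ = Real.sqrt (∫ w, ‖F j w - G w‖ ^ 2 ∂(gaussian t)) := by
    intro j
    rw [← Real.sqrt_sq (norm_nonneg (f j - g)), norm_sq_eq_integral_norm_sq]
    congr 1
    refine integral_congr_ae ?_
    filter_upwards [Lp.coeFn_sub (f j) g, hf j, hg] with w h1 h2 h3
    rw [h1, Pi.sub_apply, h2, h3]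
  simp_rw [h1]
  exact Real.sqrt_zero ▸ (Real.continuous_sqrt.tendsto 0).comp h0

/-- Dominated convergence, with the limit in `L²(ℓ², μ_t)` constructed. -/
lemma exists_tendsto_Lp_of_unifExpType (t : WeightSequence) {F : ℕ → Ell2 → ℂ} {G : Ell2 → ℂ}
    (hF : UnifExpType F) {f : ℕ → Lp ℂ 2 (gaussian t)} (hf : ∀ j, f j =ᵐ[gaussian t] F j)
    (hlim : ∀ w, Tendsto (fun j => F j w) atTop (𝓝 (G w))) :
    ∃ g : Lp ℂ 2 (gaussian t), g =ᵐ[gaussian t] G ∧ Tendsto f atTop (𝓝 g) := by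
  have hGm : AEStronglyMeasurable G (gaussian t) :=
    aestronglyMeasurable_of_tendsto_ae atTop
      (fun j => (Lp.aestronglyMeasurable (f j)).congr (hf j)) (ae_of_all _ hlim)
  have hG : MemLp G 2 (gaussian t) := by
    obtain ⟨M, c, C, hc, hb⟩ := id hF
    exact ((memLp_expWeight t M c).const_mul C).mono' hGm (ae_of_all _ fun w =>
      le_of_tendsto (hlim w).norm (Eventually.of_forall fun j => hb j w))
  exact ⟨hG.toLp, hG.coeFn_toLp, tendsto_Lp_of_unifExpType t hF hf hG.coeFn_toLp hlim⟩

/-- A property of functions that holds for the exponentials and is stable under linear combinations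
and under dominated pointwise limits holds for all products of polynomials and exponentials:
multiplication by a coordinate is a limit of difference quotients in the exponent. -/
lemma polynomial_mul_expFun_induction {Q : (Ell2 → ℂ) → Prop} (hexp : ∀ α, Q (expFun α))
    (hadd : ∀ F G, Q F → Q G → Q fun w => F w + G w) (hsmul : ∀ (c : ℂ) F, Q F → Q fun w => c * F w)
    (hlim : ∀ (F : ℕ → Ell2 → ℂ) (G : Ell2 → ℂ), UnifExpType F → (∀ j, Q (F j)) →
      (∀ w, Tendsto (fun j => F j w) atTop (𝓝 (G w))) → Q G)
    (p : MvPolynomial ℕ ℂ) (α : ℕ →₀ ℂ) : Q fun w => evalPoly p w * expFun α w := by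
  induction p using MvPolynomial.induction_on generalizing α with
  | C a => simpa only [evalPoly_C] using hsmul a _ (hexp α)
  | add p q hp hq => simpa only [evalPoly_add, add_mul] using hadd _ _ (hp α) (hq α)
  | mul_X p n hp =>
    -- `p w_n e^{α}` is the limit of `s⁻¹ (p e^{α + s w_n} - p e^{α})` along `s = 1 / (j + 1)`
    set s : ℕ → ℂ := fun j => ((j : ℂ) + 1)⁻¹
    have hs0 : ∀ j, s j ≠ 0 := fun j => inv_ne_zero (Nat.cast_add_one_ne_zero j)
    have hs1 : ∀ j, ‖s j‖ ≤ 1 := fun j => by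
      rw [norm_inv, ← Nat.cast_add_one, Complex.norm_natCast]
      exact inv_le_one_of_one_le₀ (by simp)
    have hst : Tendsto s atTop (𝓝[≠] 0) := by
      refine tendsto_nhdsWithin_iff.mpr ⟨?_, Eventually.of_forall hs0⟩
      simpa [s, one_div] using tendsto_one_div_add_atTop_nhds_zero_nat (𝕜 := ℂ)
    have hq : ∀ (j : ℕ) (w : Ell2), (s j)⁻¹ * (evalPoly p w * expFun (α + Finsupp.single n (s j)) w)
        + (-(s j)⁻¹) * (evalPoly p w * expFun α w)
        = (evalPoly p w * expFun α w) * ((s j)⁻¹ * (Complex.exp (s j * w n) - 1)) := by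
      intro j w
      have : expFun (Finsupp.single n (s j)) w = Complex.exp (s j * w n) := by
        rw [expFun, linForm_single]
      rw [expFun_add, this]
      ring
    refine hlim (fun j w => (s j)⁻¹ * (evalPoly p w * expFun (α + Finsupp.single n (s j)) w)
      + (-(s j)⁻¹) * (evalPoly p w * expFun α w)) _ ?_
      (fun j => hadd _ _ (hsmul _ _ (hp _)) (hsmul _ _ (hp _))) ?_
    · simp_rw [hq]
      refine ((unifExpType_evalPoly p).mul (unifExpType_expFun α)).mul
        (((unifExpType_coord (ι := ℕ) n).mul
          (unifExpType_exp_norm_coord zero_le_one n)).mono id fun j w => ?_)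
      have hexp1 := Complex.norm_exp_sub_sum_le_norm_mul_exp (s j * w n) 1
      simp only [Finset.range_one, Finset.sum_singleton, pow_zero, Nat.factorial_zero, Nat.cast_one,
        div_one, pow_one, norm_mul] at hexp1
      rw [norm_mul, norm_mul, norm_inv, Complex.norm_real, Real.norm_of_nonneg (Real.exp_pos _).le]
      have hpos := norm_pos_iff.mpr (hs0 j)
      calc ‖s j‖⁻¹ * ‖Complex.exp (s j * w n) - 1‖
          ≤ ‖s j‖⁻¹ * (‖s j‖ * ‖w n‖ * Real.exp (‖s j‖ * ‖w n‖)) := by gcongr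
        _ = ‖w n‖ * Real.exp (‖s j‖ * ‖w n‖) := by field_simp
        _ ≤ _ := by gcongr; exact hs1 j
    · intro w
      simp_rw [hq, evalPoly_mul_X]
      have hd : HasDerivAt (fun x : ℂ => Complex.exp (x * w n)) (w n) 0 := by
        simpa using ((hasDerivAt_id (0 : ℂ)).mul_const (w n)).cexp
      have h2 := (hd.tendsto_slope_zero.comp hst).const_mul (evalPoly p w * expFun α w)
      refine (h2.congr fun j => ?_).trans (le_of_eq (by ring_nf))
      simp

lemma mem_fockSpace_of_ae_eq_evalPoly (t : WeightSequence) (p : MvPolynomial ℕ ℂ)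
    {f : Lp ℂ 2 (gaussian t)} (hf : f =ᵐ[gaussian t] evalPoly p) : f ∈ fockSpace t := by
  have : f = polyLp t p := Lp.ext (hf.trans (MemLp.coeFn_toLp _).symm)
  rw [this]
  exact (polyFock t p).2

/-- Products of polynomials and exponentials are limits of polynomials, by the Taylor expansion of
the exponential. -/
lemma mem_fockSpace_of_ae_eq_evalPoly_mul_expFun (t : WeightSequence) (p : MvPolynomial ℕ ℂ)
    (α : ℕ →₀ ℂ) {f : Lp ℂ 2 (gaussian t)}
    (hf : f =ᵐ[gaussian t] fun w => evalPoly p w * expFun α w) : f ∈ fockSpace t := by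
  induction α using Finsupp.induction generalizing p f with
  | zero => exact mem_fockSpace_of_ae_eq_evalPoly t p (by simpa [expFun_zero] using hf)
  | single_add n c α _ _ ih =>
    set T : ℕ → MvPolynomial ℕ ℂ := fun N =>
      ∑ k ∈ Finset.range N, MvPolynomial.C (c ^ k / k.factorial : ℂ) * MvPolynomial.X n ^ k
    have hT : ∀ N (w : Ell2), evalPoly (T N) w
        = ∑ k ∈ Finset.range N, (c * w n) ^ k / (k.factorial : ℂ) := by
      intro N w
      simp only [evalPoly, T, map_sum, map_mul, map_pow, MvPolynomial.eval_C, MvPolynomial.eval_X]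
      exact Finset.sum_congr rfl fun k _ => by ring
    have hmul : ∀ N, evalPoly (p * T N) = fun w => evalPoly p w * evalPoly (T N) w := by
      intro N; funext w; simp [evalPoly]
    have hty : UnifExpType fun N w => evalPoly (p * T N) w * expFun α w := by
      simp_rw [hmul]
      refine ((unifExpType_evalPoly p).mul ((unifExpType_exp_norm_coord (ι := ℕ)
        (norm_nonneg c) n).mono id fun N w => ?_)).mul (unifExpType_expFun α)
      rw [hT, Complex.norm_real, Real.norm_of_nonneg (Real.exp_pos _).le, ← norm_mul]
      refine (norm_sum_le _ _).trans ?_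
      refine le_trans (le_of_eq ?_) (Real.sum_le_exp_of_nonneg (norm_nonneg (c * w n)) N)
      exact Finset.sum_congr rfl fun k _ => by simp
    have hm : ∀ N, MemLp (fun w => evalPoly (p * T N) w * expFun α w) 2 (gaussian t) := fun N =>
      hty.memLp t N ((measurable_evalPoly _).mul (measurable_expFun α))
    have hlim := tendsto_Lp_of_unifExpType t hty (fun N => (hm N).coeFn_toLp) hf fun w => by
      simp_rw [hmul, hT, expFun_add]
      have h1 : expFun (Finsupp.single n c) w = Complex.exp (c * w n) := by
        rw [expFun, linForm_single]
      have h2 := NormedSpace.exp_series_hasSum_exp' (𝕂 := ℂ) (c * w n : ℂ)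
      rw [← Complex.exp_eq_exp_ℂ] at h2
      rw [h1, ← mul_assoc]
      refine ((h2.tendsto_sum_nat.congr fun N => ?_).const_mul _).mul_const _
      exact Finset.sum_congr rfl fun k _ => by rw [smul_eq_mul]; ring
    exact (Submodule.isClosed_topologicalClosure _).mem_of_tendsto hlim
      (Eventually.of_forall fun N => ih (p * T N) (hm N).coeFn_toLp)

/-- The exponential `expFun α` as an element of the Fock-Bargmann space. -/
def expFock (t : WeightSequence) (α : ℕ →₀ ℂ) : Fock t :=
  ⟨(memLp_expFun t α).toLp, mem_fockSpace_of_ae_eq_evalPoly_mul_expFun t 1 α (by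
    simpa [evalPoly] using (memLp_expFun t α).coeFn_toLp)⟩

lemma coeFn_expFock (t : WeightSequence) (α : ℕ →₀ ℂ) :
    (expFock t α : Lp ℂ 2 (gaussian t)) =ᵐ[gaussian t] expFun α :=
  (memLp_expFun t α).coeFn_toLp

lemma coeFn_polyFock (t : WeightSequence) (p : MvPolynomial ℕ ℂ) :
    (polyFock t p : Lp ℂ 2 (gaussian t)) =ᵐ[gaussian t] evalPoly p :=
  MemLp.coeFn_toLp (by exact_mod_cast memLp_evalPoly t p 2)

lemma dense_span_polyFock (t : WeightSequence) :
    Dense (Submodule.span ℂ (Set.range (polyFock t)) : Set (Fock t)) := by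
  rw [Subtype.dense_iff]
  intro f hf
  have h : (Subtype.val '' (Submodule.span ℂ (Set.range (polyFock t)) : Set (Fock t)))
      = (Submodule.span ℂ (Set.range (polyLp t)) : Set (Lp ℂ 2 (gaussian t))) := by
    have := Submodule.map_span (fockSpace t).subtype (Set.range (polyFock t))
    rw [← Set.range_comp] at this
    exact congrArg SetLike.coe this
  exact closure_mono h.ge hf

lemma dense_span_expFock (t : WeightSequence) :
    Dense (Submodule.span ℂ (Set.range (expFock t)) : Set (Fock t)) := by
  rw [Subtype.dense_iff]
  set S : Submodule ℂ (Lp ℂ 2 (gaussian t)) :=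
    Submodule.span ℂ (Set.range fun α => (expFock t α : Lp ℂ 2 (gaussian t)))
  have h : (Subtype.val '' (Submodule.span ℂ (Set.range (expFock t)) : Set (Fock t)))
      = (S : Set (Lp ℂ 2 (gaussian t))) := by
    have := Submodule.map_span (fockSpace t).subtype (Set.range (expFock t))
    rw [← Set.range_comp] at this
    exact congrArg SetLike.coe this
  suffices hS : fockSpace t ≤ S.topologicalClosure from
    fun f hf => closure_mono h.ge (hS hf)
  refine Submodule.topologicalClosure_minimal _ (Submodule.span_le.mpr ?_)
    (Submodule.isClosed_topologicalClosure _)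
  rintro _ ⟨p, rfl⟩
  have key := polynomial_mul_expFun_induction (Q := fun F => ∃ f ∈ S.topologicalClosure,
      f =ᵐ[gaussian t] F) ?_ ?_ ?_ ?_ p 0
  · obtain ⟨f, hfS, hf⟩ := key
    have : polyLp t p = f := by
      refine Lp.ext ((coeFn_polyFock t p).trans ?_)
      simpa [expFun_zero] using hf.symm
    rw [this]
    exact hfS
  · exact fun α => ⟨expFock t α, S.le_topologicalClosure (Submodule.subset_span ⟨α, rfl⟩),
      coeFn_expFock t α⟩
  · rintro F G ⟨f, hfS, hf⟩ ⟨g, hgS, hg⟩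
    exact ⟨f + g, add_mem hfS hgS, (Lp.coeFn_add f g).trans (hf.add hg)⟩
  · rintro c F ⟨f, hfS, hf⟩
    exact ⟨c • f, Submodule.smul_mem _ c hfS, (Lp.coeFn_smul c f).trans (hf.const_smul c)⟩
  · intro F G hty hF hlim
    choose f hfS hf using hF
    obtain ⟨g, hg, hfg⟩ := exists_tendsto_Lp_of_unifExpType t hty hf hlim
    exact ⟨g, (Submodule.isClosed_topologicalClosure _).mem_of_tendsto hfg
      (Eventually.of_forall hfS), hg⟩

/-- Bounded operators that agree on the exponentials are equal. -/
lemma ext_expFock {t : WeightSequence} {E : Type*} [NormedAddCommGroup E] [NormedSpace ℂ E]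
    {A B : Fock t →L[ℂ] E} (h : ∀ α, A (expFock t α) = B (expFock t α)) : A = B :=
  ContinuousLinearMap.ext_on (dense_span_expFock t) (by rintro _ ⟨α, rfl⟩; exact h α)

/-- Bounded operators that agree on the polynomials are equal. -/
lemma ext_polyFock {t : WeightSequence} {E : Type*} [NormedAddCommGroup E] [NormedSpace ℂ E]
    {A B : Fock t →L[ℂ] E} (h : ∀ p, A (polyFock t p) = B (polyFock t p)) : A = B :=
  ContinuousLinearMap.ext_on (dense_span_polyFock t) (by rintro _ ⟨p, rfl⟩; exact h p)

/-- Vectors that have the same inner products with all exponentials are equal. -/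
lemma ext_inner_expFock {t : WeightSequence} {f g : Fock t}
    (h : ∀ α, inner ℂ (expFock t α) f = inner ℂ (expFock t α) g) : f = g := by
  have : innerSL ℂ f = innerSL ℂ g := ext_expFock fun α => by
    simpa using congrArg (starRingEnd ℂ) (h α)
  exact (innerSL_inj (𝕜 := ℂ)).mp this

/-! ### The Cameron-Martin norm and the measurable linear functionals -/

/-- The isometry `z ↦ (z_n / √t_n)` of the Cameron-Martin space into `ℓ²`, through which its norm
and its symplectic form are expressed by those of `ℓ²`. -/
def cmEmbed (t : WeightSequence) : cameronMartin t →ₗ[ℂ] Ell2 where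
  toFun z := ⟨fun n => (z : Ell2) n / (Real.sqrt (t.val n) : ℂ), memℓp_gen <| by
    refine z.2.congr fun n => ?_
    rw [ENNReal.toReal_ofNat, ← Nat.cast_ofNat (R := ℝ), Real.rpow_natCast, norm_div, div_pow,
      Complex.norm_real, Real.norm_eq_abs, sq_abs, Real.sq_sqrt (t.pos n).le]⟩
  map_add' z w := lp.ext (funext fun _ => add_div _ _ _)
  map_smul' c z := lp.ext (funext fun _ => mul_div_assoc _ _ _)

lemma cmEmbed_apply (t : WeightSequence) (z : cameronMartin t) (n : ℕ) :
    cmEmbed t z n = (z : Ell2) n / (Real.sqrt (t.val n) : ℂ) := rfl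

lemma norm_cmEmbed_apply_sq (t : WeightSequence) (z : cameronMartin t) (n : ℕ) :
    ‖cmEmbed t z n‖ ^ 2 = ‖(z : Ell2) n‖ ^ 2 / t.val n := by
  rw [cmEmbed_apply, norm_div, div_pow, Complex.norm_real, Real.norm_eq_abs, sq_abs,
    Real.sq_sqrt (t.pos n).le]

lemma norm_sq_eq_tsum_norm_sq (z : Ell2) : ‖z‖ ^ 2 = ∑' n, ‖z n‖ ^ 2 := by
  have := lp.norm_rpow_eq_tsum (p := 2) (by norm_num) z
  simpa using this

lemma norm_cmEmbed (t : WeightSequence) (z : cameronMartin t) :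
    ‖cmEmbed t z‖ = halfNorm t z := by
  rw [halfNorm, ← Real.sqrt_sq (norm_nonneg (cmEmbed t z)), norm_sq_eq_tsum_norm_sq]
  simp_rw [norm_cmEmbed_apply_sq]

lemma inner_cmEmbed_apply (t : WeightSequence) (w z : cameronMartin t) (n : ℕ) :
    inner ℂ (cmEmbed t z n) (cmEmbed t w n)
      = (w : Ell2) n * conj ((z : Ell2) n) / (t.val n : ℂ) := by
  have h : (t.val n : ℂ) = (Real.sqrt (t.val n) : ℂ) * (Real.sqrt (t.val n) : ℂ) := by
    rw [← Complex.ofReal_mul, Real.mul_self_sqrt (t.pos n).le]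
  rw [cmEmbed_apply, cmEmbed_apply, h]
  simp only [RCLike.inner_apply, map_div₀, Complex.conj_ofReal]
  ring

lemma sympl_eq_im_inner (t : WeightSequence) (z w : cameronMartin t) :
    sympl t z w = (inner ℂ (cmEmbed t w) (cmEmbed t z) : ℂ).im := by
  rw [sympl, lp.inner_eq_tsum, ← Complex.imCLM_apply,
    Complex.imCLM.map_tsum (lp.summable_inner _ _)]
  refine tsum_congr fun n => ?_
  rw [inner_cmEmbed_apply, Complex.imCLM_apply, Complex.div_ofReal_im]

lemma halfInner_eq_inner (t : WeightSequence) (w z : cameronMartin t) :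
    halfInner t w z = inner ℂ (cmEmbed t z) (cmEmbed t w) := by
  rw [halfInner, lp.inner_eq_tsum]
  exact tsum_congr fun n => (inner_cmEmbed_apply t w z n).symm

/-- The constant `2` comes from the bound `‖w_n‖² ≤ 4 t_n` for the coordinates in `L²`. -/
lemma norm_halfInnerLp_le (t : WeightSequence) (z : cameronMartin t) :
    ‖halfInnerLp t z‖ ≤ 2 * ‖cmEmbed t z‖ := by
  set v : ℕ → Lp ℂ 2 (gaussian t) := fun n => (conj ((z : Ell2) n) / (t.val n : ℂ)) • coordLp t n
  have hv : ∀ n, ‖v n‖ ^ 2 ≤ 4 * ‖cmEmbed t z n‖ ^ 2 := by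
    intro n
    have ht := t.pos n
    simp only [v, norm_cmEmbed_apply_sq, norm_smul, mul_pow, norm_div, RCLike.norm_conj,
      Complex.norm_real, div_pow, Real.norm_eq_abs, sq_abs]
    calc ‖(z : Ell2) n‖ ^ 2 / t.val n ^ 2 * ‖coordLp t n‖ ^ 2
        ≤ ‖(z : Ell2) n‖ ^ 2 / t.val n ^ 2 * (4 * t.val n) := by
          gcongr; exact norm_coordLp_sq_le t n
      _ = 4 * (‖(z : Ell2) n‖ ^ 2 / t.val n) := by field_simp
  have hsum : ∀ N, ‖∑ n ∈ Finset.range N, v n‖ ^ 2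
      ≤ ∑ n ∈ Finset.range N, 4 * ‖cmEmbed t z n‖ ^ 2 := by
    intro N
    induction N with
    | zero => simp
    | succ N ih =>
      rw [Finset.sum_range_succ, Finset.sum_range_succ, norm_add_sq (𝕜 := ℂ)]
      have h0 : inner ℂ (∑ n ∈ Finset.range N, v n) (v N) = 0 := by
        rw [sum_inner]
        refine Finset.sum_eq_zero fun n hn => ?_
        simp only [v, inner_smul_left, inner_smul_right,
          inner_coordLp t (Finset.mem_range.mp hn).ne, mul_zero]
      rw [h0, map_zero, mul_zero, add_zero]
      exact add_le_add ih (hv N)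
  have hs : Summable fun n => 4 * ‖cmEmbed t z n‖ ^ 2 := by
    simp_rw [norm_cmEmbed_apply_sq]
    exact z.2.mul_left 4
  have hle : ∀ N, ‖∑ n ∈ Finset.range N, v n‖ ≤ 2 * ‖cmEmbed t z‖ := by
    intro N
    refine (sq_le_sq₀ (norm_nonneg _) (by positivity)).mp ?_
    calc _ ≤ ∑ n ∈ Finset.range N, 4 * ‖cmEmbed t z n‖ ^ 2 := hsum N
      _ ≤ ∑' n, 4 * ‖cmEmbed t z n‖ ^ 2 := hs.sum_le_tsum _ fun n _ => by positivity
      _ = _ := by rw [tsum_mul_left, mul_pow, norm_sq_eq_tsum_norm_sq]; norm_num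
  exact le_of_tendsto (summable_halfInnerLp t z).hasSum.tendsto_sum_nat.norm
    (Eventually.of_forall hle)

lemma halfInnerLp_add (t : WeightSequence) (z w : cameronMartin t) :
    halfInnerLp t (z + w) = halfInnerLp t z + halfInnerLp t w := by
  rw [halfInnerLp, halfInnerLp, halfInnerLp,
    ← (summable_halfInnerLp t z).tsum_add (summable_halfInnerLp t w)]
  refine tsum_congr fun n => ?_
  rw [← add_smul]
  congr 1
  simp [add_div]

lemma halfInnerLp_smul (t : WeightSequence) (c : ℂ) (z : cameronMartin t) :
    halfInnerLp t (c • z) = conj c • halfInnerLp t z := by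
  rw [halfInnerLp, halfInnerLp, ← (summable_halfInnerLp t z).tsum_const_smul]
  refine tsum_congr fun n => ?_
  rw [smul_smul]
  congr 1
  simp [mul_div_assoc]

lemma symplFun_smul (t : WeightSequence) (s : ℝ) (z : cameronMartin t) :
    symplFun t ((s : ℂ) • z) =ᵐ[gaussian t] fun w => s * symplFun t z w := by
  filter_upwards [Lp.coeFn_smul (conj (s : ℂ)) (halfInnerLp t z)] with w hw
  rw [symplFun, halfInnerLp_smul, hw]
  simp [symplFun]

lemma symplFun_sub (t : WeightSequence) (z w : cameronMartin t) :
    (fun x => symplFun t z x - symplFun t w x) =ᵐ[gaussian t] symplFun t (z - w) := by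
  have h : halfInnerLp t (z - w) = halfInnerLp t z - halfInnerLp t w := by
    rw [eq_sub_iff_add_eq, ← halfInnerLp_add, sub_add_cancel]
  filter_upwards [Lp.coeFn_sub (halfInnerLp t z) (halfInnerLp t w)] with x hx
  rw [symplFun, symplFun, symplFun, h, hx]
  simp

lemma measurable_symplFun (t : WeightSequence) (z : cameronMartin t) :
    Measurable (symplFun t z) :=
  Complex.measurable_im.comp (Lp.stronglyMeasurable _).measurable

lemma finVec_mem_spaceH1 (t : WeightSequence) (α : ℕ →₀ ℂ) :
    (finVec t α : Ell2) ∈ spaceH1 t := by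
  refine summable_of_ne_finset_zero (s := α.support) fun n hn => ?_
  simp [Finsupp.notMem_support_iff.mp hn]

lemma halfInner_finVec (t : WeightSequence) (α : ℕ →₀ ℂ) (w : Ell2) :
    halfInner t w (finVec t α) = linForm α w := by
  rw [halfInner, linForm_eq_sum α subset_rfl, tsum_eq_sum (s := α.support)]
  · refine Finset.sum_congr rfl fun n _ => ?_
    have : (t.val n : ℂ) ≠ 0 := by exact_mod_cast (t.pos n).ne'
    simp
    field_simp
  · intro n hn
    simp [Finsupp.notMem_support_iff.mp hn]

lemma symplFun_finVec (t : WeightSequence) (α : ℕ →₀ ℂ) :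
    symplFun t (finVec t α) =ᵐ[gaussian t] fun w => (linForm α w).im := by
  filter_upwards [halfInnerLp_ae_eq t _ (finVec_mem_spaceH1 t α)] with w hw
  rw [symplFun, hw, halfInner_finVec]

/-! ### Toeplitz operators -/

lemma coeFn_mulOp (t : WeightSequence) (φ : Lp ℂ ∞ (gaussian t)) (f : Lp ℂ 2 (gaussian t)) :
    mulOp t φ f =ᵐ[gaussian t] fun w => φ w * f w :=
  ContinuousLinearMap.coeFn_holder _ φ f

lemma inner_toeplitz (t : WeightSequence) (φ : Lp ℂ ∞ (gaussian t)) (g f : Fock t) :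
    inner ℂ g (toeplitz t φ f)
      = ∫ w, φ w * (f : Lp ℂ 2 (gaussian t)) w * conj ((g : Lp ℂ 2 (gaussian t)) w)
          ∂(gaussian t) := by
  have h : inner ℂ g (toeplitz t φ f) = inner ℂ (g : Lp ℂ 2 (gaussian t)) (mulOp t φ f) :=
    Submodule.inner_orthogonalProjectionOnto_eq_of_mem_left g _
  rw [h, L2.inner_def]
  refine integral_congr_ae ?_
  filter_upwards [coeFn_mulOp t φ f] with w hw
  rw [hw]
  rfl

lemma norm_toeplitz_apply_le (t : WeightSequence) (φ : Lp ℂ ∞ (gaussian t)) (f : Fock t) :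
    ‖toeplitz t φ f‖ ≤ ‖mulOp t φ (f : Lp ℂ 2 (gaussian t))‖ :=
  Submodule.norm_orthogonalProjectionOnto_apply_le (fockSpace t) (mulOp t φ f)

lemma norm_toeplitz_sub_toeplitz_apply_le (t : WeightSequence) (φ ψ : Lp ℂ ∞ (gaussian t))
    (f : Fock t) : ‖toeplitz t φ f - toeplitz t ψ f‖
      ≤ ‖mulOp t φ (f : Lp ℂ 2 (gaussian t)) - mulOp t ψ (f : Lp ℂ 2 (gaussian t))‖ := by
  have h : ∀ χ, toeplitz t χ f = (fockSpace t).orthogonalProjectionOnto (mulOp t χ f) :=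
    fun _ => rfl
  rw [h, h, ← map_sub]
  exact Submodule.norm_orthogonalProjectionOnto_apply_le (fockSpace t) _

/-- The adjoint of a Toeplitz operator has the conjugate symbol. -/
lemma adjoint_toeplitz (t : WeightSequence) {φ ψ : Lp ℂ ∞ (gaussian t)}
    (h : ψ =ᵐ[gaussian t] fun w => conj (φ w)) : star (toeplitz t φ) = toeplitz t ψ := by
  rw [ContinuousLinearMap.star_eq_adjoint]
  refine ((ContinuousLinearMap.eq_adjoint_iff _ _).mpr fun f g => ?_).symm
  rw [inner_toeplitz, ← inner_conj_symm, inner_toeplitz, ← integral_conj]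
  refine integral_congr_ae ?_
  filter_upwards [h] with w hw
  simp only [hw, map_mul, Complex.conj_conj]
  ring

/-! ### The Weyl operators -/

lemma norm_exp_two_I_mul (x : ℝ) : ‖Complex.exp (2 * Complex.I * x)‖ = 1 := by
  rw [show (2 * Complex.I * x : ℂ) = Complex.I * ((2 * x : ℝ) : ℂ) by push_cast; ring]
  exact Complex.norm_exp_I_mul_ofReal _

lemma measurable_phase (t : WeightSequence) (z : cameronMartin t) :
    Measurable fun w => Complex.exp (2 * Complex.I * symplFun t z w) := by
  have := measurable_symplFun t z
  fun_prop

lemma memLp_phase (t : WeightSequence) (z : cameronMartin t) :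
    MemLp (fun w => Complex.exp (2 * Complex.I * symplFun t z w)) ∞ (gaussian t) :=
  memLp_top_of_bound (measurable_phase t z).aestronglyMeasurable 1
    (ae_of_all _ fun _ => (norm_exp_two_I_mul _).le)

/-- The unimodular symbol `e^{2iσ(·, z)}`. -/
def phaseLp (t : WeightSequence) (z : cameronMartin t) : Lp ℂ ∞ (gaussian t) :=
  (memLp_phase t z).toLp

lemma coeFn_phaseLp (t : WeightSequence) (z : cameronMartin t) :
    phaseLp t z =ᵐ[gaussian t] fun w => Complex.exp (2 * Complex.I * symplFun t z w) :=
  (memLp_phase t z).coeFn_toLp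

lemma norm_toeplitz_phaseLp_le (t : WeightSequence) (z : cameronMartin t) :
    ‖toeplitz t (phaseLp t z)‖ ≤ 1 := by
  refine ContinuousLinearMap.opNorm_le_bound _ zero_le_one fun f => ?_
  rw [one_mul, Submodule.coe_norm]
  refine (norm_toeplitz_apply_le t _ f).trans (Lp.norm_le_norm_of_ae_le ?_)
  filter_upwards [coeFn_mulOp t (phaseLp t z) f, coeFn_phaseLp t z] with w h1 h2
  rw [h1, h2, norm_mul, norm_exp_two_I_mul, one_mul]
  exact le_rfl

/-- The Weyl operator `W_z`, written as the multiple `e^{‖z‖²/2} T_φ` of the Toeplitz operator with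
the symbol `φ = e^{2iσ(·, z)}`. This makes sense for all `z` in the Cameron-Martin space. -/
def weyl (t : WeightSequence) (z : cameronMartin t) : Fock t →L[ℂ] Fock t :=
  (Real.exp (halfNorm t z ^ 2 / 2) : ℂ) • toeplitz t (phaseLp t z)

lemma halfNorm_neg (t : WeightSequence) (z : cameronMartin t) :
    halfNorm t (-z : cameronMartin t) = halfNorm t z := by
  rw [← norm_cmEmbed, ← norm_cmEmbed, map_neg, norm_neg]

lemma star_weyl (t : WeightSequence) (z : cameronMartin t) : star (weyl t z) = weyl t (-z) := by
  rw [weyl, weyl, star_smul, halfNorm_neg, adjoint_toeplitz t (ψ := phaseLp t (-z))]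
  · congr 1
    exact Complex.conj_ofReal _
  · have h1 := symplFun_smul t (-1) z
    simp only [Complex.ofReal_neg, Complex.ofReal_one, neg_smul, one_smul] at h1
    filter_upwards [coeFn_phaseLp t z, coeFn_phaseLp t (-z), h1] with w h2 h3 h4
    rw [h2, h3, h4, ← Complex.exp_conj]
    congr 1
    simp only [map_mul, Complex.conj_I, Complex.conj_ofReal, map_ofNat]
    push_cast
    ring

/-- Strong convergence of a bounded family of operators only has to be checked on a set with dense
span. -/
lemma tendsto_apply_of_dense {F ι : Type*} [NormedAddCommGroup F] [NormedSpace ℂ F] {l : Filter ι}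
    {A : ι → F →L[ℂ] F} {B : F →L[ℂ] F} {C : ℝ} (hA : ∀ i, ‖A i‖ ≤ C) (hB : ‖B‖ ≤ C) {S : Set F}
    (hS : Dense (Submodule.span ℂ S : Set F))
    (h : ∀ f ∈ S, Tendsto (fun i => A i f) l (𝓝 (B f))) (f : F) :
    Tendsto (fun i => A i f) l (𝓝 (B f)) := by
  have hspan : ∀ f ∈ Submodule.span ℂ S, Tendsto (fun i => A i f) l (𝓝 (B f)) := by
    intro f hf
    induction hf using Submodule.span_induction with
    | mem f hf => exact h f hf
    | zero => simpa using tendsto_const_nhds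
    | add f g _ _ hf hg => simpa using hf.add hg
    | smul c f _ hf => simpa using hf.const_smul c
  have hC : 0 ≤ C := (norm_nonneg B).trans hB
  rw [Metric.tendsto_nhds]
  intro ε hε
  have hδ : 0 < ε / (3 * (C + 1)) := by positivity
  obtain ⟨g, hg, hfg⟩ := Metric.dense_iff.mp hS f _ hδ
  rw [Metric.mem_ball, dist_comm, dist_eq_norm] at hg
  have hb : ∀ T : F →L[ℂ] F, ‖T‖ ≤ C → ‖T f - T g‖ < ε / 3 := by
    intro T hT
    rw [← map_sub]
    calc ‖T (f - g)‖ ≤ ‖T‖ * ‖f - g‖ := T.le_opNorm _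
      _ ≤ (C + 1) * ‖f - g‖ := by gcongr; linarith
      _ < (C + 1) * (ε / (3 * (C + 1))) := by gcongr
      _ = ε / 3 := by field_simp
  filter_upwards [Metric.tendsto_nhds.mp (hspan g hfg) (ε / 3) (by positivity)] with i hi
  rw [dist_eq_norm] at hi ⊢
  calc ‖A i f - B f‖ = ‖(A i f - A i g) + (A i g - B g) - (B f - B g)‖ := by congr 1; abel
    _ ≤ ‖A i f - A i g‖ + ‖A i g - B g‖ + ‖B f - B g‖ :=
        (norm_sub_le _ _).trans (by gcongr; exact norm_add_le _ _)
    _ < ε := by linarith [hb (A i) (hA i), hb B hB]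

/-- Cauchy-Schwarz estimate for the difference of two phases on an exponential, whose square is
again an exponential in `L²`. -/
lemma norm_toeplitz_phaseLp_sub_apply_sq_le (t : WeightSequence) (z z' : cameronMartin t)
    (α : ℕ →₀ ℂ) :
    ‖toeplitz t (phaseLp t z') (expFock t α) - toeplitz t (phaseLp t z) (expFock t α)‖ ^ 2
      ≤ 8 * ‖cmEmbed t (z' - z)‖ * ‖expFock t (α + α)‖ := by
  set f : Lp ℂ 2 (gaussian t) := (expFock t α).1
  set D : Lp ℂ 2 (gaussian t) := mulOp t (phaseLp t z') f - mulOp t (phaseLp t z) f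
  set S := halfInnerLp t (z' - z)
  set E : Lp ℂ 2 (gaussian t) := (expFock t (α + α)).1
  have h1 : ‖toeplitz t (phaseLp t z') (expFock t α) - toeplitz t (phaseLp t z) (expFock t α)‖
      ≤ ‖D‖ := norm_toeplitz_sub_toeplitz_apply_le t _ _ _
  have hint : Integrable (fun w => ‖S w‖ * ‖E w‖) (gaussian t) :=
    (Lp.memLp S).norm.integrable_mul (Lp.memLp E).norm
  have h2 : ∀ᵐ w ∂(gaussian t), ‖D w‖ ^ 2 ≤ 4 * (‖S w‖ * ‖E w‖) := by
    filter_upwards [Lp.coeFn_sub (mulOp t (phaseLp t z') f) (mulOp t (phaseLp t z) f),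
      coeFn_mulOp t (phaseLp t z') f, coeFn_mulOp t (phaseLp t z) f, coeFn_phaseLp t z',
      coeFn_phaseLp t z, coeFn_expFock t α, coeFn_expFock t (α + α), symplFun_sub t z' z]
      with w e1 e2 e3 e4 e5 e6 e7 e8
    have hphase : Complex.exp (2 * Complex.I * symplFun t z' w)
        - Complex.exp (2 * Complex.I * symplFun t z w)
        = Complex.exp (2 * Complex.I * symplFun t z w) *
          (Complex.exp (Complex.I * ((2 * symplFun t (z' - z) w : ℝ) : ℂ)) - 1) := by
      rw [← e8, mul_sub, ← Complex.exp_add]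
      congr 2
      · push_cast; ring
      · ring
    set u := Complex.exp (Complex.I * ((2 * symplFun t (z' - z) w : ℝ) : ℂ)) - 1
    have hu1 : ‖u‖ ≤ 2 * ‖S w‖ := by
      refine Real.norm_exp_I_mul_ofReal_sub_one_le.trans ?_
      rw [Real.norm_eq_abs, abs_mul, abs_two]
      exact mul_le_mul_of_nonneg_left (Complex.abs_im_le_norm _) two_pos.le
    have hu2 : ‖u‖ ≤ 2 := by
      refine (norm_sub_le _ _).trans ?_
      rw [Complex.norm_exp_I_mul_ofReal]
      norm_num
    have hE : ‖E w‖ = ‖f w‖ ^ 2 := by rw [e7, e6, expFun_add, norm_mul, sq]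
    have hD : D w = Complex.exp (2 * Complex.I * symplFun t z w) * u * f w := by
      rw [e1, Pi.sub_apply, e2, e3, e4, e5, ← sub_mul, hphase]
    rw [hD, norm_mul, norm_mul, norm_exp_two_I_mul, one_mul, mul_pow, hE]
    -- one factor `‖u‖ ≤ 2` is given away, so that only two factors in `L²` remain
    have : ‖u‖ ^ 2 ≤ 4 * ‖S w‖ := by
      rw [sq]
      calc ‖u‖ * ‖u‖ ≤ 2 * (2 * ‖S w‖) := by gcongr
        _ = _ := by ring
    calc ‖u‖ ^ 2 * ‖f w‖ ^ 2 ≤ 4 * ‖S w‖ * ‖f w‖ ^ 2 := by gcongr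
      _ = _ := by ring
  have h3 : ∫ w, ‖S w‖ * ‖E w‖ ∂(gaussian t) ≤ ‖S‖ * ‖E‖ := by
    have := integral_mul_norm_le_Lp_mul_Lq (μ := gaussian t) (f := S) (g := E)
      Real.HolderConjugate.two_two (by simpa using Lp.memLp S) (by simpa using Lp.memLp E)
    refine this.trans (le_of_eq ?_)
    simp_rw [← Nat.cast_ofNat (R := ℝ) (n := 2), Real.rpow_natCast]
    rw [← norm_sq_eq_integral_norm_sq, ← norm_sq_eq_integral_norm_sq, Nat.cast_ofNat,
      ← Real.sqrt_eq_rpow, ← Real.sqrt_eq_rpow, Real.sqrt_sq (norm_nonneg _),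
      Real.sqrt_sq (norm_nonneg _)]
  calc _ ≤ ‖D‖ ^ 2 := pow_le_pow_left₀ (norm_nonneg _) h1 2
    _ = ∫ w, ‖D w‖ ^ 2 ∂(gaussian t) := norm_sq_eq_integral_norm_sq D
    _ ≤ ∫ w, 4 * (‖S w‖ * ‖E w‖) ∂(gaussian t) :=
        integral_mono_ae (Lp.memLp D).norm.integrable_sq (hint.const_mul 4) h2
    _ ≤ 4 * (2 * ‖cmEmbed t (z' - z)‖ * ‖E‖) := by
        rw [integral_const_mul]
        gcongr
        exact h3.trans (by gcongr; exact norm_halfInnerLp_le t _)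
    _ = _ := by simp only [E, Submodule.coe_norm]; ring

/-- Strong continuity of `z ↦ W_z` with respect to the Cameron-Martin norm. -/
lemma tendsto_weyl_apply (t : WeightSequence) {ι : Type*} {l : Filter ι} {z : ι → cameronMartin t}
    {z₀ : cameronMartin t} (h : Tendsto (fun i => cmEmbed t (z i)) l (𝓝 (cmEmbed t z₀)))
    (f : Fock t) : Tendsto (fun i => weyl t (z i) f) l (𝓝 (weyl t z₀ f)) := by
  have hT : Tendsto (fun i => toeplitz t (phaseLp t (z i)) f) l
      (𝓝 (toeplitz t (phaseLp t z₀) f)) := by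
    refine tendsto_apply_of_dense (fun i => norm_toeplitz_phaseLp_le t (z i))
      (norm_toeplitz_phaseLp_le t z₀) (dense_span_expFock t) ?_ f
    rintro _ ⟨α, rfl⟩
    rw [tendsto_iff_norm_sub_tendsto_zero]
    have h0 : Tendsto (fun i => Real.sqrt (8 * ‖cmEmbed t (z i - z₀)‖ * ‖expFock t (α + α)‖)) l
        (𝓝 0) := by
      have := (((tendsto_iff_norm_sub_tendsto_zero.mp h).const_mul 8).mul_const
        ‖expFock t (α + α)‖).sqrt
      simpa using this
    exact squeeze_zero (fun _ => norm_nonneg _) (fun i =>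
      Real.le_sqrt_of_sq_le (norm_toeplitz_phaseLp_sub_apply_sq_le t z₀ (z i) α)) h0
  have hc : Tendsto (fun i => (Real.exp (halfNorm t (z i) ^ 2 / 2) : ℂ)) l
      (𝓝 (Real.exp (halfNorm t z₀ ^ 2 / 2) : ℂ)) := by
    simp_rw [← norm_cmEmbed]
    have : Continuous fun x : Ell2 => (Real.exp (‖x‖ ^ 2 / 2) : ℂ) := by fun_prop
    exact (this.tendsto _).comp h
  exact hc.smul hT

/-! ### Weyl operators at finitely supported points -/

lemma halfNorm_sq_eq_halfInner (t : WeightSequence) (z : cameronMartin t) :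
    ((halfNorm t z ^ 2 : ℝ) : ℂ) = halfInner t z z := by
  rw [halfInner_eq_inner, ← norm_cmEmbed, inner_self_eq_norm_sq_to_K]
  simp

lemma halfNorm_finVec_sq (t : WeightSequence) (α : ℕ →₀ ℂ) :
    ((halfNorm t (finVec t α) ^ 2 : ℝ) : ℂ) = linForm α (finVec t α) := by
  rw [halfNorm_sq_eq_halfInner, halfInner_finVec]

lemma inner_expFock (t : WeightSequence) (α β : ℕ →₀ ℂ) :
    inner ℂ (expFock t β) (expFock t α) = Complex.exp (linForm α (finVec t β)) := by
  rw [← integral_expFun_mul_conj]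
  refine (L2.inner_def (𝕜 := ℂ) (expFock t β).1 (expFock t α).1).trans (integral_congr_ae ?_)
  filter_upwards [coeFn_expFock t α, coeFn_expFock t β] with w h1 h2
  rw [h1, h2]
  rfl

/-- The Weyl operators translate the reproducing kernels. -/
lemma weyl_finVec_expFock (t : WeightSequence) (γ α : ℕ →₀ ℂ) :
    weyl t (finVec t γ) (expFock t α)
      = Complex.exp (-(linForm γ (finVec t γ) / 2) - linForm α (finVec t γ)) •
        expFock t (α + γ) := by
  refine ext_inner_expFock fun β => ?_
  have h1 : inner ℂ (expFock t β) (toeplitz t (phaseLp t (finVec t γ)) (expFock t α))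
      = Complex.exp (linForm (α + γ) (finVec t (β + -γ))) := by
    rw [inner_toeplitz, ← integral_expFun_mul_conj]
    refine integral_congr_ae ?_
    filter_upwards [coeFn_phaseLp t (finVec t γ), symplFun_finVec t γ, coeFn_expFock t α,
      coeFn_expFock t β] with w h1 h2 h3 h4
    rw [h1, h2, h3, h4, expFun_add, expFun_add, map_mul]
    have : Complex.exp (2 * Complex.I * ((linForm γ w).im : ℂ))
        = expFun γ w * conj (expFun (-γ) w) := by
      rw [expFun, expFun, linForm_neg, ← Complex.exp_conj, ← Complex.exp_add, map_neg,
        ← sub_eq_add_neg, Complex.sub_conj]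
      congr 1
      push_cast
      ring
    rw [this]
    ring
  refine Eq.trans ?_ (inner_smul_right (𝕜 := ℂ) (expFock t β) (expFock t (α + γ)) _).symm
  rw [weyl, smul_apply, inner_smul_right, h1, inner_expFock, Complex.ofReal_exp, ← Complex.exp_add, ← Complex.exp_add, Complex.ofReal_div,
    halfNorm_finVec_sq, finVec_add, finVec_neg, Submodule.coe_add, Submodule.coe_neg,
    ← sub_eq_add_neg, linForm_sub_right, linForm_add α γ (finVec t γ)]
  congr 1
  push_cast
  ring

lemma sympl_finVec (t : WeightSequence) (γ δ : ℕ →₀ ℂ) :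
    (Complex.I * (sympl t (finVec t γ) (finVec t δ) : ℂ))
      = (linForm δ (finVec t γ) - linForm γ (finVec t δ)) / 2 := by
  have hc : linForm γ (finVec t δ) = conj (linForm δ (finVec t γ)) := by
    rw [← halfInner_finVec t, ← halfInner_finVec t, halfInner_eq_inner, halfInner_eq_inner,
      inner_conj_symm]
  rw [sympl_eq_im_inner, ← halfInner_eq_inner, halfInner_finVec, hc, Complex.sub_conj]
  push_cast
  ring

lemma weyl_finVec_mul_weyl_finVec (t : WeightSequence) (γ δ : ℕ →₀ ℂ) :
    weyl t (finVec t γ) * weyl t (finVec t δ)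
      = Complex.exp (-(Complex.I * (sympl t (finVec t γ) (finVec t δ) : ℂ))) •
        weyl t (finVec t γ + finVec t δ) := by
  refine ext_expFock fun α => ?_
  rw [mul_apply_eq_comp, weyl_finVec_expFock, map_smul, weyl_finVec_expFock, smul_smul,
    ← Complex.exp_add, smul_apply, ← finVec_add, weyl_finVec_expFock, smul_smul,
    ← Complex.exp_add, sympl_finVec, add_assoc α δ γ, add_comm δ γ]
  congr 2
  simp only [finVec_add, Submodule.coe_add, linForm_add, linForm_add_right]
  ring

/-- A limit in `L²` of functions that converge pointwise is the pointwise limit. -/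
lemma ae_eq_of_tendsto_Lp {α : Type*} {m : MeasurableSpace α} {μ : Measure α} {F : ℕ → α → ℂ}
    {G : α → ℂ} {f : ℕ → Lp ℂ 2 μ} {g : Lp ℂ 2 μ} (hf : ∀ j, f j =ᵐ[μ] F j)
    (hlim : ∀ w, Tendsto (fun j => F j w) atTop (𝓝 (G w))) (h : Tendsto f atTop (𝓝 g)) :
    g =ᵐ[μ] G := by
  obtain ⟨φ, hφ, hφlim⟩ := (tendstoInMeasure_of_tendsto_Lp h).exists_seq_tendsto_ae
  filter_upwards [hφlim, ae_all_iff.mpr hf] with w h1 h2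
  exact tendsto_nhds_unique h1
    (((hlim w).comp hφ.tendsto_atTop).congr fun i => (h2 (φ i)).symm)

lemma weyl_finVec_polyFock (t : WeightSequence) (γ : ℕ →₀ ℂ) (p : MvPolynomial ℕ ℂ) :
    (weyl t (finVec t γ) (polyFock t p) : Lp ℂ 2 (gaussian t)) =ᵐ[gaussian t]
      fun w => normKernel t (finVec t γ) w * evalPoly p (w - finVec t γ) := by
  -- the limits in `L²` on both sides are identified through the pointwise limits
  have key := polynomial_mul_expFun_induction (Q := fun F => ∃ f : Fock t,
      (f : Lp ℂ 2 (gaussian t)) =ᵐ[gaussian t] F ∧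
      (weyl t (finVec t γ) f : Lp ℂ 2 (gaussian t)) =ᵐ[gaussian t]
        fun w => normKernel t (finVec t γ) w * F (w - finVec t γ)) ?_ ?_ ?_ ?_ p 0
  · obtain ⟨f, hf, hWf⟩ := key
    simp only [expFun_zero, mul_one] at hf hWf
    have : polyFock t p = f := Subtype.ext (Lp.ext ((coeFn_polyFock t p).trans hf.symm))
    rw [this]
    exact hWf
  · intro α
    refine ⟨expFock t α, coeFn_expFock t α, ?_⟩
    rw [weyl_finVec_expFock]
    refine (Lp.coeFn_smul _ (expFock t (α + γ)).1).trans ?_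
    filter_upwards [coeFn_expFock t (α + γ)] with w hw
    rw [Pi.smul_apply, hw, normKernel, halfInner_finVec, Complex.ofReal_div, halfNorm_finVec_sq,
      expFun, expFun, smul_eq_mul, ← Complex.exp_add, ← Complex.exp_add, linForm_add,
      linForm_sub_right]
    congr 1
    push_cast
    ring
  · rintro F G ⟨f, hf, hWf⟩ ⟨g, hg, hWg⟩
    refine ⟨f + g, (Lp.coeFn_add f.1 g.1).trans (hf.add hg), ?_⟩
    rw [map_add]
    refine (Lp.coeFn_add (weyl t (finVec t γ) f).1 (weyl t (finVec t γ) g).1).trans ?_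
    filter_upwards [hWf, hWg] with w h1 h2
    rw [Pi.add_apply, h1, h2, mul_add]
  · rintro c F ⟨f, hf, hWf⟩
    refine ⟨c • f, (Lp.coeFn_smul c f.1).trans (hf.const_smul c), ?_⟩
    rw [map_smul]
    refine (Lp.coeFn_smul c (weyl t (finVec t γ) f).1).trans ?_
    filter_upwards [hWf] with w h1
    rw [Pi.smul_apply, h1, smul_eq_mul]
    ring
  · intro F G hty hF hlim
    choose f hf hWf using hF
    obtain ⟨g, hg, hfg⟩ := exists_tendsto_Lp_of_unifExpType t hty hf hlim
    have hgF : g ∈ fockSpace t := (Submodule.isClosed_topologicalClosure _).mem_of_tendsto hfg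
      (Eventually.of_forall fun j => (f j).2)
    have hfg' : Tendsto f atTop (𝓝 (⟨g, hgF⟩ : Fock t)) := tendsto_subtype_rng.mpr hfg
    refine ⟨⟨g, hgF⟩, hg, ae_eq_of_tendsto_Lp hWf (fun w => (hlim _).const_mul _) ?_⟩
    exact (continuous_subtype_val.tendsto _).comp
      (((weyl t (finVec t γ)).continuous.tendsto _).comp hfg')

/-! ### Truncation, and the Weyl system -/

/-- The exponent whose point `finVec` consists of the first `N` coordinates of `z`. -/
def truncExp (t : WeightSequence) (z : Ell2) (N : ℕ) : ℕ →₀ ℂ :=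
  Finsupp.onFinset (Finset.range N) (fun n => if n < N then conj (z n) / (t.val n : ℂ) else 0)
    fun n hn => by
      rw [Finset.mem_range]
      by_contra h
      exact hn (if_neg h)

lemma truncExp_apply (t : WeightSequence) (z : Ell2) (N n : ℕ) :
    truncExp t z N n = if n < N then conj (z n) / (t.val n : ℂ) else 0 := rfl

lemma finVec_truncExp_apply (t : WeightSequence) (z : Ell2) (N n : ℕ) :
    (finVec t (truncExp t z N) : Ell2) n = if n < N then z n else 0 := by
  have : (t.val n : ℂ) ≠ 0 := by exact_mod_cast (t.pos n).ne'
  rw [finVec_apply, truncExp_apply]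
  split_ifs
  · simp
    field_simp
  · simp

/-- The finitely supported points are dense in the Cameron-Martin space. -/
lemma tendsto_cmEmbed_finVec_truncExp (t : WeightSequence) (z : cameronMartin t) :
    Tendsto (fun N => cmEmbed t (finVec t (truncExp t z N))) atTop (𝓝 (cmEmbed t z)) := by
  have h := (lp.hasSum_single (p := 2) (by norm_num) (cmEmbed t z)).tendsto_sum_nat
  refine h.congr fun N => lp.ext (funext fun n => ?_)
  rw [lp.coeFn_sum, Finset.sum_apply, cmEmbed_apply, finVec_truncExp_apply]
  simp only [lp.coeFn_single, Pi.single_apply, Finset.sum_ite_eq, Finset.mem_range]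
  split_ifs <;> simp [cmEmbed_apply]

/-- The formula for the Weyl operators on polynomials extends from the finitely supported points to
`H_1`, where both sides are limits along the truncations. -/
lemma weyl_polyFock (t : WeightSequence) (z : cameronMartin t) (hz : (z : Ell2) ∈ spaceH1 t)
    (p : MvPolynomial ℕ ℂ) :
    (weyl t z (polyFock t p) : Lp ℂ 2 (gaussian t)) =ᵐ[gaussian t]
      fun w => normKernel t z w * evalPoly p (w - z) := by
  have hJ := tendsto_cmEmbed_finVec_truncExp t z
  have hW := (continuous_subtype_val.tendsto _).comp (tendsto_weyl_apply t hJ (polyFock t p))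
  refine ae_eq_of_tendsto_Lp (fun N => weyl_finVec_polyFock t (truncExp t z N) p) (fun w => ?_) hW
  refine Tendsto.mul ?_ ?_
  · refine (Complex.continuous_exp.tendsto _).comp (Tendsto.sub ?_ ?_)
    · simp_rw [halfInner_finVec]
      have hw : Summable fun n => ‖w n‖ ^ 2 := by simpa using (lp.memℓp w).summable (by norm_num)
      have hsum : Summable fun n => w n * conj ((z : Ell2) n) / (t.val n : ℂ) := by
        refine Summable.of_norm_bounded (hw.add hz) fun n => ?_
        rw [norm_div, norm_mul, RCLike.norm_conj, Complex.norm_real, Real.norm_eq_abs,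
          abs_of_pos (t.pos n), mul_div_assoc, ← div_pow]
        have : 0 ≤ ‖(z : Ell2) n‖ / t.val n := div_nonneg (norm_nonneg _) (t.pos n).le
        nlinarith [sq_nonneg (‖w n‖ - ‖(z : Ell2) n‖ / t.val n), norm_nonneg (w n)]
      refine hsum.hasSum.tendsto_sum_nat.congr fun N => ?_
      rw [linForm_eq_sum (truncExp t z N) Finsupp.support_onFinset_subset]
      refine Finset.sum_congr rfl fun n hn => ?_
      rw [truncExp_apply, if_pos (Finset.mem_range.mp hn)]
      ring
    · refine (Complex.continuous_ofReal.tendsto _).comp ?_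
      simp_rw [← norm_cmEmbed]
      exact (hJ.norm.pow 2).div_const 2
  · refine ((MvPolynomial.continuous_eval p).tendsto _).comp (tendsto_pi_nhds.mpr fun n => ?_)
    refine tendsto_const_nhds.congr' ?_
    filter_upwards [eventually_gt_atTop n] with N hN
    rw [lp.coeFn_sub, lp.coeFn_sub, Pi.sub_apply, Pi.sub_apply, finVec_truncExp_apply, if_pos hN]

lemma isWeylSystem_weyl (t : WeightSequence) : IsWeylSystem t (weyl t) where
  apply_poly := weyl_polyFock t
  strongly_continuous z f ε hε := by
    have h := tendsto_weyl_apply t (z := id) (l := comap (cmEmbed t) (𝓝 (cmEmbed t z)))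
      tendsto_comap f
    have h1 := (Metric.nhds_basis_ball.comap (cmEmbed t)).tendsto_iff Metric.nhds_basis_ball |>.mp
      h ε hε
    obtain ⟨δ, hδ, hball⟩ := h1
    refine ⟨δ, hδ, fun z' hz' => ?_⟩
    rw [← norm_cmEmbed, map_sub, ← dist_eq_norm] at hz'
    rw [← dist_eq_norm]
    exact hball z' hz'

/-- There is at most one Weyl system: polynomials are dense in the Fock-Bargmann space, and `H_1` is
dense in the Cameron-Martin space. -/
lemma IsWeylSystem.eq_weyl {t : WeightSequence} {W : cameronMartin t → (Fock t →L[ℂ] Fock t)}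
    (hW : IsWeylSystem t W) : W = weyl t := by
  have hfin : ∀ γ, W (finVec t γ) = weyl t (finVec t γ) := fun γ => ext_polyFock fun p =>
    Subtype.ext (Lp.ext ((hW.apply_poly _ (finVec_mem_spaceH1 t γ) p).trans
      (weyl_finVec_polyFock t γ p).symm))
  funext z
  refine ContinuousLinearMap.ext fun f => ?_
  have hJ := tendsto_cmEmbed_finVec_truncExp t z
  refine tendsto_nhds_unique ?_ (tendsto_weyl_apply t hJ f)
  simp_rw [← hfin]
  rw [Metric.tendsto_nhds]
  intro ε hε
  obtain ⟨δ, hδ, h⟩ := hW.strongly_continuous z f ε hε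
  filter_upwards [Metric.tendsto_nhds.mp hJ δ hδ] with N hN
  rw [dist_eq_norm]
  refine h _ ?_
  rwa [← norm_cmEmbed, map_sub, ← dist_eq_norm]

/-- The canonical commutation relations in Weyl form. -/
lemma weyl_mul_weyl (t : WeightSequence) (z w : cameronMartin t) :
    weyl t z * weyl t w = Complex.exp (-(Complex.I * (sympl t z w : ℂ))) • weyl t (z + w) := by
  have hcont : Continuous fun x : Ell2 × Ell2 =>
      Complex.exp (-(Complex.I * ((inner ℂ x.2 x.1 : ℂ).im : ℂ))) := by fun_prop
  have hright : ∀ {u v : ℕ → cameronMartin t} {u₀ v₀ : cameronMartin t} (f : Fock t),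
      Tendsto (fun N => cmEmbed t (u N)) atTop (𝓝 (cmEmbed t u₀)) →
      Tendsto (fun N => cmEmbed t (v N)) atTop (𝓝 (cmEmbed t v₀)) →
      Tendsto (fun N => (Complex.exp (-(Complex.I * (sympl t (u N) (v N) : ℂ))) •
        weyl t (u N + v N)) f) atTop
        (𝓝 ((Complex.exp (-(Complex.I * (sympl t u₀ v₀ : ℂ))) • weyl t (u₀ + v₀)) f)) := by
    intro u v u₀ v₀ f hu hv
    simp_rw [sympl_eq_im_inner]
    refine ((hcont.tendsto _).comp (hu.prodMk_nhds hv)).smul (tendsto_weyl_apply t ?_ f)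
    simpa using hu.add hv
  have hw := tendsto_cmEmbed_finVec_truncExp t w
  have hz := tendsto_cmEmbed_finVec_truncExp t z
  -- the limit in the first point is taken for a fixed operator on the right, the limit in the
  -- second one under the bounded operator `weyl t z`
  have h1 : ∀ δ, weyl t z * weyl t (finVec t δ)
      = Complex.exp (-(Complex.I * (sympl t z (finVec t δ) : ℂ))) • weyl t (z + finVec t δ) := by
    refine fun δ => ContinuousLinearMap.ext fun f => ?_
    refine tendsto_nhds_unique ?_ (hright f hz tendsto_const_nhds)
    simp_rw [← weyl_finVec_mul_weyl_finVec]
    exact tendsto_weyl_apply t hz _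
  refine ContinuousLinearMap.ext fun f => ?_
  refine tendsto_nhds_unique ?_ (hright f tendsto_const_nhds hw)
  simp_rw [← h1]
  exact ((weyl t z).continuous.tendsto _).comp (tendsto_weyl_apply t hw f)

lemma weyl_zero (t : WeightSequence) : weyl t 0 = 1 := by
  refine ext_expFock fun α => ?_
  have h : finVec t 0 = 0 := Subtype.ext (lp.ext (funext fun n => by simp))
  have := weyl_finVec_expFock t 0 α
  rw [h] at this
  rw [this, linForm_eq_sum α subset_rfl]
  simp [linForm]

lemma sympl_smul_smul (t : WeightSequence) (a b : ℝ) (z : cameronMartin t) :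
    sympl t ((a : ℂ) • z : cameronMartin t) ((b : ℂ) • z : cameronMartin t) = 0 := by
  rw [sympl_eq_im_inner, map_smul, map_smul, inner_smul_left, inner_smul_right,
    inner_self_eq_norm_sq_to_K]
  simp [← Complex.ofReal_pow]

lemma weyl_mem_unitary (t : WeightSequence) (z : cameronMartin t) :
    weyl t z ∈ unitary (Fock t →L[ℂ] Fock t) := by
  have h : ∀ z : cameronMartin t, weyl t z * weyl t (-z) = 1 := by
    intro z
    have hs := sympl_smul_smul t 1 (-1) z
    simp only [Complex.ofReal_neg, Complex.ofReal_one, neg_smul, one_smul] at hs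
    rw [weyl_mul_weyl, hs, add_neg_cancel, weyl_zero]
    simp
  rw [Unitary.mem_iff, star_weyl]
  exact ⟨by simpa using h (-z), h z⟩

lemma norm_weyl_le (t : WeightSequence) (z : cameronMartin t) : ‖weyl t z‖ ≤ 1 :=
  ContinuousLinearMap.opNorm_le_bound _ zero_le_one fun f => by
    rw [ContinuousLinearMap.norm_map_of_mem_unitary (weyl_mem_unitary t z), one_mul]

/-! ### Resolvents of generators of contraction groups -/

/-- A strongly continuous one-parameter group of contractions. -/
structure IsContractionGroup {F : Type*} [NormedAddCommGroup F] [NormedSpace ℂ F]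
    (U : ℝ → (F →L[ℂ] F)) : Prop where
  zero : U 0 = 1
  add : ∀ r s, U (r + s) = U r * U s
  continuous : ∀ f, Continuous fun s => U s f
  norm_le : ∀ s, ‖U s‖ ≤ 1

section Resolvent

variable {F : Type*} [NormedAddCommGroup F] [NormedSpace ℂ F] {U : ℝ → (F →L[ℂ] F)} {lam : ℂ}

lemma norm_cexp_neg_mul_ofReal (lam : ℂ) (s : ℝ) :
    ‖Complex.exp (-(lam * s))‖ = Real.exp (-lam.re * s) := by
  rw [Complex.norm_exp]
  simp

lemma IsContractionGroup.norm_apply_le (hU : IsContractionGroup U) (s : ℝ) (f : F) :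
    ‖U s f‖ ≤ ‖f‖ :=
  ((U s).le_of_opNorm_le (hU.norm_le s) f).trans (one_mul _).le

lemma IsContractionGroup.continuous_laplace (hU : IsContractionGroup U) (lam : ℂ) (f : F) :
    Continuous fun s : ℝ => Complex.exp (-(lam * s)) • U s f :=
  Continuous.smul (by fun_prop) (hU.continuous f)

lemma IsContractionGroup.norm_laplace_le (hU : IsContractionGroup U) (lam : ℂ) (f : F) (s : ℝ) :
    ‖Complex.exp (-(lam * s)) • U s f‖ ≤ Real.exp (-lam.re * s) * ‖f‖ := by
  rw [norm_smul, norm_cexp_neg_mul_ofReal]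
  gcongr
  exact hU.norm_apply_le s f

lemma IsContractionGroup.integrableOn_laplace (hU : IsContractionGroup U) (hlam : 0 < lam.re)
    (f : F) (a : ℝ) : IntegrableOn (fun s : ℝ => Complex.exp (-(lam * s)) • U s f) (Set.Ioi a) := by
  have h : IntegrableOn (fun s : ℝ => Real.exp (-lam.re * s) * ‖f‖) (Set.Ioi a) :=
    (integrableOn_exp_mul_Ioi (by linarith) a).mul_const _
  exact h.mono' (hU.continuous_laplace lam f).aestronglyMeasurable
    (ae_of_all _ (hU.norm_laplace_le lam f))

/-- The Laplace transform `∫₀^∞ e^{-lam s} U_s ds` of a contraction group. -/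
def laplaceOp {U : ℝ → (F →L[ℂ] F)} (hU : IsContractionGroup U) {lam : ℂ} (hlam : 0 < lam.re) :
    F →L[ℂ] F :=
  LinearMap.mkContinuous
    { toFun := fun f => ∫ s in Set.Ioi (0 : ℝ), Complex.exp (-(lam * s)) • U s f
      map_add' := fun f g => by
        simp_rw [map_add, smul_add]
        exact integral_add (hU.integrableOn_laplace hlam f 0) (hU.integrableOn_laplace hlam g 0)
      map_smul' := fun c f => by
        simp_rw [map_smul, smul_comm _ c]
        exact integral_smul c _ }
    (∫ s in Set.Ioi (0 : ℝ), Real.exp (-lam.re * s))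
    (fun f => by
      rw [← integral_mul_const]
      exact norm_integral_le_of_norm_le
        ((integrableOn_exp_mul_Ioi (by linarith) 0).mul_const _)
        (ae_of_all _ (hU.norm_laplace_le lam f)))

lemma laplaceOp_apply (hU : IsContractionGroup U) (hlam : 0 < lam.re) (f : F) :
    laplaceOp hU hlam f = ∫ s in Set.Ioi (0 : ℝ), Complex.exp (-(lam * s)) • U s f := rfl

lemma isGeneratorValue_iff_hasDerivAt (hU : IsContractionGroup U) {f h : F} :
    IsGeneratorValue U f h ↔ HasDerivAt (fun s => U s f) (Complex.I • h) 0 := by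
  rw [hasDerivAt_iff_tendsto_slope_zero, IsGeneratorValue]
  refine tendsto_congr fun s => ?_
  rw [zero_add, hU.zero, one_apply_eq_self, ← Complex.ofReal_inv, Complex.coe_smul]

lemma hasDerivAt_group (hU : IsContractionGroup U) {f g : F}
    (h : HasDerivAt (fun s => U s f) g 0) (s : ℝ) : HasDerivAt (fun s => U s f) (U s g) s := by
  rw [hasDerivAt_iff_tendsto_slope_zero] at h ⊢
  refine (((U s).continuous.tendsto g).comp h).congr fun r => ?_
  simp only [Function.comp_apply, zero_add, hU.zero, one_apply_eq_self]
  rw [← Complex.coe_smul, ← Complex.coe_smul, map_smul, map_sub, hU.add, mul_apply_eq_comp]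

lemma IsResolvent.eq {R R' : F →L[ℂ] F} (h : IsResolvent U lam R) (h' : IsResolvent U lam R') :
    R = R' := by
  refine ContinuousLinearMap.ext fun f => ?_
  obtain ⟨g, hg, hgf⟩ := h.right_inv f
  rw [← h'.left_inv _ _ hg, hgf]

lemma IsGeneratorValue.comp_neg {f g : F} (h : IsGeneratorValue U f g) :
    IsGeneratorValue (fun s => U (-s)) f (-g) := by
  have hneg : Tendsto (fun s : ℝ => -s) (𝓝[≠] 0) (𝓝[≠] 0) := by
    refine tendsto_nhdsWithin_iff.mpr ⟨?_, ?_⟩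
    · exact (continuous_neg.tendsto' (0 : ℝ) 0 neg_zero).mono_left nhdsWithin_le_nhds
    · filter_upwards [self_mem_nhdsWithin] with s hs
      exact neg_ne_zero.mpr hs
  rw [IsGeneratorValue, smul_neg]
  refine ((Tendsto.comp h hneg).neg).congr fun s => ?_
  simp only [Function.comp_apply]
  rw [← neg_smul, Complex.ofReal_neg, inv_neg, neg_neg]

/-- Reversing the time of a group changes the sign of its generator. -/
lemma IsResolvent.comp_neg {R : F →L[ℂ] F} (h : IsResolvent U lam R) :
    IsResolvent (fun s => U (-s)) (-lam) (-R) where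
  right_inv f := by
    obtain ⟨g, hg, hgf⟩ := h.right_inv (-f)
    refine ⟨-g, by simpa using hg.comp_neg, ?_⟩
    rw [map_neg] at hgf
    rw [← neg_inj, ← hgf, neg_apply]
    module
  left_inv f g hfg := by
    have hg : IsGeneratorValue U f (-g) := by simpa using hfg.comp_neg
    have := h.left_inv _ _ hg
    rw [neg_apply, ← map_neg]
    convert! this using 2
    module

variable [CompleteSpace F]

/-- The Laplace transform maps into the domain of the generator: translating the integrand gives
`U_h R f = e^{lam h} (R f - ∫₀^h e^{-lam s} U_s f ds)`, which is differentiable in `h`. -/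
lemma hasDerivAt_laplaceOp (hU : IsContractionGroup U) (hlam : 0 < lam.re) (f : F) :
    HasDerivAt (fun h => U h (laplaceOp hU hlam f)) (lam • laplaceOp hU hlam f - f) 0 := by
  set g : ℝ → F := fun s => Complex.exp (-(lam * s)) • U s f
  have hg : Continuous g := hU.continuous_laplace lam f
  have key : ∀ h : ℝ, U h (laplaceOp hU hlam f)
      = Complex.exp (lam * h) • (laplaceOp hU hlam f - ∫ s in (0 : ℝ)..h, g s) := by
    intro h
    have h1 : ∫ s in Set.Ioi (0 : ℝ), g (s + h) = ∫ s in Set.Ioi h, g s := by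
      have := (measurePreserving_add_right (volume : Measure ℝ) h).setIntegral_preimage_emb
        (measurableEmbedding_addRight h) g (Set.Ioi h)
      simpa using this
    have h2 := intervalIntegral.integral_interval_add_Ioi
      (hU.integrableOn_laplace hlam f 0) (hU.integrableOn_laplace hlam f h)
    rw [laplaceOp_apply, ← (U h).integral_comp_comm (hU.integrableOn_laplace hlam f 0), ← h2,
      add_sub_cancel_left, ← h1, ← integral_smul]
    refine integral_congr_ae (ae_of_all _ fun s => ?_)
    simp only [g]
    rw [map_smul, smul_smul, ← Complex.exp_add, add_comm s h, hU.add, mul_apply_eq_comp]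
    congr 2
    push_cast
    ring
  have hd1 : HasDerivAt (fun h : ℝ => Complex.exp (lam * h)) lam 0 := by
    have := ((Complex.ofRealCLM.hasDerivAt (x := (0 : ℝ))).const_mul lam).cexp
    simpa using this
  have hd2 : HasDerivAt (fun h : ℝ => laplaceOp hU hlam f - ∫ s in (0 : ℝ)..h, g s) (-g 0) 0 :=
    (intervalIntegral.integral_hasDerivAt_right (hg.intervalIntegrable 0 0)
      (hg.stronglyMeasurableAtFilter _ _) hg.continuousAt).const_sub _
  have := hd1.smul hd2
  rw [funext key]
  convert! this using 1
  simp [g, hU.zero]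
  abel

/-- The Laplace transform inverts `lam` minus the derivative of the group, by partial
integration. -/
lemma laplaceOp_apply_of_hasDerivAt (hU : IsContractionGroup U) (hlam : 0 < lam.re) {f g : F}
    (h : HasDerivAt (fun s => U s f) g 0) :
    laplaceOp hU hlam g = lam • laplaceOp hU hlam f - f := by
  have hd : ∀ s : ℝ, HasDerivAt (fun s : ℝ => Complex.exp (-(lam * s)) • U s f)
      (Complex.exp (-(lam * s)) • U s g - lam • (Complex.exp (-(lam * s)) • U s f)) s := by
    intro s
    have h1 : HasDerivAt (fun s : ℝ => Complex.exp (-(lam * s)))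
        (Complex.exp (-(lam * s)) * -lam) s := by
      have := ((Complex.ofRealCLM.hasDerivAt (x := s)).const_mul lam).neg.cexp
      simpa using this
    convert! h1.smul (hasDerivAt_group hU h s) using 1
    rw [smul_smul, mul_neg, neg_smul, sub_eq_add_neg, mul_comm lam (Complex.exp _)]
  have hint := (hU.integrableOn_laplace hlam g 0).sub
    ((hU.integrableOn_laplace hlam f 0).smul lam)
  have hlim : Tendsto (fun s : ℝ => Complex.exp (-(lam * s)) • U s f) atTop (𝓝 0) := by
    refine squeeze_zero_norm (hU.norm_laplace_le lam f) ?_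
    have : Tendsto (fun s : ℝ => Real.exp (-lam.re * s)) atTop (𝓝 0) :=
      Real.tendsto_exp_atBot.comp (tendsto_id.const_mul_atTop_of_neg (by linarith))
    simpa using this.mul_const ‖f‖
  have hftc := integral_Ioi_of_hasDerivAt_of_tendsto' (a := (0 : ℝ)) (fun s _ => hd s) hint hlim
  have hsub := integral_sub (hU.integrableOn_laplace hlam g 0)
    ((hU.integrableOn_laplace hlam f 0).smul lam)
  simp only [Pi.smul_apply] at hsub
  rw [hsub, integral_smul, ← laplaceOp_apply hU hlam, ← laplaceOp_apply hU hlam] at hftc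
  simp only [Complex.ofReal_zero, mul_zero, neg_zero, Complex.exp_zero, one_smul, hU.zero,
    one_apply_eq_self, zero_sub] at hftc
  rw [sub_eq_iff_eq_add] at hftc
  rw [hftc]
  abel

lemma isResolvent_laplaceOp (hU : IsContractionGroup U) (hlam : 0 < lam.re) :
    IsResolvent U (-lam) (-Complex.I • laplaceOp hU hlam) where
  right_inv f := by
    refine ⟨f - lam • laplaceOp hU hlam f, ?_, ?_⟩
    · rw [isGeneratorValue_iff_hasDerivAt hU]
      have := (hasDerivAt_laplaceOp hU hlam f).const_smul (-Complex.I)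
      convert! this using 1
      · funext s
        simp
      · rw [neg_smul, ← smul_neg, neg_sub]
    · rw [smul_apply, smul_smul]
      have : Complex.I * -lam * -Complex.I = -lam := by
        linear_combination lam * Complex.I_sq
      rw [this, neg_smul]
      abel
  left_inv f h hfh := by
    have h1 := laplaceOp_apply_of_hasDerivAt hU hlam ((isGeneratorValue_iff_hasDerivAt hU).mp hfh)
    rw [map_smul] at h1
    rw [smul_apply, map_sub, map_smul, smul_sub, smul_smul]
    have h2 : -Complex.I * (Complex.I * -lam) = -lam := by
      linear_combination lam * Complex.I_sq
    rw [h2, neg_smul, h1]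
    module

end Resolvent

/-! ### The resolvent as a series of Toeplitz operators -/

lemma integrableOn_pow_mul_exp {b : ℝ} (hb : 0 < b) (k : ℕ) :
    IntegrableOn (fun s : ℝ => s ^ k * Real.exp (-b * s)) (Set.Ioi 0) := by
  have := integrableOn_rpow_mul_exp_neg_mul_rpow (p := 1) (s := k) (b := b)
    (by linarith [k.cast_nonneg (α := ℝ)]) one_pos hb
  simpa using this

lemma integrableOn_pow_mul_cexp {mu : ℂ} (hmu : 0 < mu.re) (k : ℕ) :
    IntegrableOn (fun s : ℝ => (s : ℂ) ^ k * Complex.exp (-(mu * s))) (Set.Ioi 0) := by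
  refine (integrableOn_pow_mul_exp hmu k).mono' (Continuous.aestronglyMeasurable (by fun_prop)) ?_
  filter_upwards [ae_restrict_mem measurableSet_Ioi] with s hs
  rw [norm_mul, norm_pow, Complex.norm_real, Real.norm_of_nonneg (le_of_lt hs),
    norm_cexp_neg_mul_ofReal]

lemma integral_pow_mul_cexp {mu : ℂ} (hmu : 0 < mu.re) (k : ℕ) :
    ∫ s in Set.Ioi (0 : ℝ), (s : ℂ) ^ k * Complex.exp (-(mu * s))
      = k.factorial * mu⁻¹ ^ (k + 1) := by
  have hmu0 : mu ≠ 0 := fun h => by simp [h] at hmu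
  have hexp : ∀ s : ℝ, HasDerivAt (fun s : ℝ => Complex.exp (-(mu * s)))
      (Complex.exp (-(mu * s)) * -mu) s := by
    intro s
    have := ((Complex.ofRealCLM.hasDerivAt (x := s)).const_mul mu).neg.cexp
    simpa using this
  have hlim : ∀ k : ℕ, Tendsto (fun s : ℝ => (s : ℂ) ^ k * Complex.exp (-(mu * s))) atTop (𝓝 0) := by
    intro k
    have h0 := Real.tendsto_pow_mul_exp_neg_atTop_nhds_zero k
    have h1 := (h0.comp (tendsto_id.const_mul_atTop hmu)).const_mul ((mu.re⁻¹) ^ k)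
    rw [mul_zero] at h1
    refine squeeze_zero_norm' ?_ h1
    filter_upwards [eventually_ge_atTop 0] with s hs
    rw [norm_mul, norm_pow, Complex.norm_real, Real.norm_of_nonneg hs, norm_cexp_neg_mul_ofReal]
    simp only [Function.comp_apply, id_eq]
    rw [mul_pow, ← mul_assoc, ← mul_assoc, ← mul_pow, inv_mul_cancel₀ hmu.ne', one_pow, one_mul,
      neg_mul]
  induction k with
  | zero =>
    have h := integral_Ioi_of_hasDerivAt_of_tendsto' (a := (0 : ℝ))
      (fun s _ => hexp s)
      (by simpa [IntegrableOn] using (integrableOn_pow_mul_cexp hmu 0).mul_const (-mu))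
      (by simpa using hlim 0)
    rw [integral_mul_const] at h
    simp only [pow_zero, one_mul, Nat.factorial_zero, Nat.cast_one, zero_add, pow_one]
    simp only [Complex.ofReal_zero, mul_zero, neg_zero, Complex.exp_zero, zero_sub, mul_neg,
      neg_inj] at h
    exact eq_inv_of_mul_eq_one_left h
  | succ k ih =>
    have hd : ∀ s : ℝ, HasDerivAt (fun s : ℝ => (s : ℂ) ^ (k + 1) * Complex.exp (-(mu * s)))
        (((k : ℂ) + 1) * ((s : ℂ) ^ k * Complex.exp (-(mu * s)))
          - mu * ((s : ℂ) ^ (k + 1) * Complex.exp (-(mu * s)))) s := by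
      intro s
      have h1 : HasDerivAt (fun s : ℝ => (s : ℂ) ^ (k + 1)) (((k : ℂ) + 1) * (s : ℂ) ^ k) s := by
        have := (Complex.ofRealCLM.hasDerivAt (x := s)).fun_pow (k + 1)
        simpa using this
      convert! h1.mul (hexp s) using 1
      ring
    have i1 := (integrableOn_pow_mul_cexp hmu k).const_mul ((k : ℂ) + 1)
    have i2 := (integrableOn_pow_mul_cexp hmu (k + 1)).const_mul mu
    have h := integral_Ioi_of_hasDerivAt_of_tendsto' (a := (0 : ℝ)) (fun s _ => hd s) (i1.sub i2)
      (hlim (k + 1))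
    rw [integral_sub i1 i2, integral_const_mul, integral_const_mul, ih] at h
    simp only [Complex.ofReal_zero, ne_eq, Nat.add_eq_zero_iff, one_ne_zero, and_false,
      not_false_eq_true, zero_pow, zero_mul, sub_zero] at h
    have h2 := (sub_eq_zero.mp h).symm
    rw [pow_succ, Nat.factorial_succ]
    push_cast
    have h3 : ∀ x y : ℂ, mu * x = y → x = y * mu⁻¹ := by
      rintro x _ rfl
      field_simp
    rw [h3 _ _ h2]
    ring

lemma isContractionGroup_weylGroup (t : WeightSequence) (z : cameronMartin t) :
    IsContractionGroup (weylGroup (weyl t) z) where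
  zero := by simp [weylGroup, weyl_zero]
  add r s := by
    rw [weylGroup, weylGroup, weylGroup, weyl_mul_weyl, sympl_smul_smul]
    simp [add_smul]
  continuous f := by
    refine continuous_iff_continuousAt.mpr fun s => tendsto_weyl_apply t ?_ f
    simp_rw [map_smul]
    have : Continuous fun s : ℝ => (s : ℂ) • cmEmbed t z := by fun_prop
    exact this.tendsto s
  norm_le s := norm_weyl_le t _

lemma norm_inv_sub_two_I_mul_le {lam : ℂ} (hlam : 0 < lam.re) (x : ℝ) :
    ‖(lam - 2 * Complex.I * x)⁻¹‖ ≤ lam.re⁻¹ := by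
  rw [norm_inv]
  refine inv_anti₀ hlam ?_
  have := Complex.re_le_norm (lam - 2 * Complex.I * x)
  simpa using this

lemma memLp_classicalResolvent_pow (t : WeightSequence) (z : cameronMartin t) {lam : ℂ}
    (hlam : 0 < lam.re) (k : ℕ) :
    MemLp (fun w => (lam - 2 * Complex.I * symplFun t z w)⁻¹ ^ (k + 1)) ∞ (gaussian t) := by
  have hm : Measurable fun w => (lam - 2 * Complex.I * symplFun t z w)⁻¹ ^ (k + 1) := by
    have := measurable_symplFun t z
    fun_prop
  refine memLp_top_of_bound hm.aestronglyMeasurable (lam.re⁻¹ ^ (k + 1)) (ae_of_all _ fun w => ?_)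
  rw [norm_pow]
  exact pow_le_pow_left₀ (norm_nonneg _) (norm_inv_sub_two_I_mul_le hlam _) _

/-- The symbol `(lam - 2iσ(·, z))^{-(k+1)}`, a power of a classical resolvent function. -/
def classicalResolventPow (t : WeightSequence) (z : cameronMartin t) {lam : ℂ}
    (hlam : 0 < lam.re) (k : ℕ) : Lp ℂ ∞ (gaussian t) :=
  (memLp_classicalResolvent_pow t z hlam k).toLp

lemma coeFn_classicalResolventPow (t : WeightSequence) (z : cameronMartin t) {lam : ℂ}
    (hlam : 0 < lam.re) (k : ℕ) : classicalResolventPow t z hlam k =ᵐ[gaussian t]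
      fun w => (lam - 2 * Complex.I * symplFun t z w)⁻¹ ^ (k + 1) :=
  (memLp_classicalResolvent_pow t z hlam k).coeFn_toLp

lemma classicalResolventPow_mem (t : WeightSequence) (z : cameronMartin t) {lam : ℂ}
    (hlam : 0 < lam.re) (k : ℕ) :
    classicalResolventPow t z hlam k ∈ classicalResolventAlgebra t := by
  refine Set.mem_sInter.mpr fun A hA => ?_
  obtain ⟨hA, hsub⟩ := hA
  have h0 : classicalResolventPow t z hlam 0 ∈ A := by
    refine hsub ⟨lam, z, hlam.ne', ?_⟩
    simpa using coeFn_classicalResolventPow t z hlam 0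
  induction k with
  | zero => exact h0
  | succ k ih =>
    refine hA.mul_mem _ ih _ h0 _ ?_
    filter_upwards [coeFn_classicalResolventPow t z hlam 0, coeFn_classicalResolventPow t z hlam k,
      coeFn_classicalResolventPow t z hlam (k + 1)] with w h1 h2 h3
    rw [h1, h2, h3]
    ring

/-- The matrix elements of the Toeplitz operator with symbol `e^{2isσ(·, z)}`. -/
lemma inner_weylGroup_eq_integral (t : WeightSequence) (z : cameronMartin t) (g f : Fock t)
    (s : ℝ) :
    (Real.exp (-(halfNorm t z ^ 2 / 2 * s ^ 2)) : ℂ) * inner ℂ g (weylGroup (weyl t) z s f)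
      = ∫ w, Complex.exp (2 * Complex.I * (s * symplFun t z w : ℝ)) *
          (f : Lp ℂ 2 (gaussian t)) w * conj ((g : Lp ℂ 2 (gaussian t)) w) ∂(gaussian t) := by
  have hn : halfNorm t ((s : ℂ) • z : cameronMartin t) ^ 2 = halfNorm t z ^ 2 * s ^ 2 := by
    rw [← norm_cmEmbed, ← norm_cmEmbed, map_smul, norm_smul, mul_pow, Complex.norm_real,
      Real.norm_eq_abs, sq_abs, mul_comm]
  rw [weylGroup, weyl, smul_apply, inner_smul_right, hn, ← mul_assoc, ← Complex.ofReal_mul,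
    ← Real.exp_add, inner_toeplitz]
  have h0 : -(halfNorm t z ^ 2 / 2 * s ^ 2) + halfNorm t z ^ 2 * s ^ 2 / 2 = 0 := by ring
  rw [h0, Real.exp_zero, Complex.ofReal_one, one_mul]
  refine integral_congr_ae ?_
  filter_upwards [coeFn_phaseLp t ((s : ℂ) • z), symplFun_smul t s z] with w h1 h2
  rw [h1, h2]

/-- The Toeplitz operators with the powers of a classical resolvent function as symbols are Gaussian
averages of Weyl operators, by Fubini and the Laplace transform
`k! μ^{-(k+1)} = ∫₀^∞ s^k e^{-μ s} ds`. -/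
lemma factorial_mul_inner_toeplitz_classicalResolventPow (t : WeightSequence)
    (z : cameronMartin t) {lam : ℂ} (hlam : 0 < lam.re) (k : ℕ) (g f : Fock t) :
    k.factorial * inner ℂ g (toeplitz t (classicalResolventPow t z hlam k) f)
      = ∫ s in Set.Ioi (0 : ℝ), (s : ℂ) ^ k * Complex.exp (-(lam * s)) *
          ((Real.exp (-(halfNorm t z ^ 2 / 2 * s ^ 2)) : ℂ) *
            inner ℂ g (weylGroup (weyl t) z s f)) := by
  set q : Ell2 → ℂ := fun w => (f : Lp ℂ 2 (gaussian t)) w * conj ((g : Lp ℂ 2 (gaussian t)) w)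
  have hq : Integrable q (gaussian t) := L2.integrable_inner (𝕜 := ℂ) g.1 f.1
  have h1 : k.factorial * inner ℂ g (toeplitz t (classicalResolventPow t z hlam k) f)
      = ∫ w, (∫ s in Set.Ioi (0 : ℝ), q w * ((s : ℂ) ^ k * Complex.exp (-(lam * s))) *
          Complex.exp (2 * Complex.I * (s * symplFun t z w : ℝ))) ∂(gaussian t) := by
    rw [inner_toeplitz, ← integral_const_mul]
    refine integral_congr_ae ?_
    filter_upwards [coeFn_classicalResolventPow t z hlam k] with w hw
    have hre : 0 < (lam - 2 * Complex.I * symplFun t z w).re := by simpa using hlam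
    have hint : ∫ s in Set.Ioi (0 : ℝ), q w * ((s : ℂ) ^ k * Complex.exp (-(lam * s))) *
          Complex.exp (2 * Complex.I * (s * symplFun t z w : ℝ))
        = ∫ s in Set.Ioi (0 : ℝ), q w * ((s : ℂ) ^ k *
          Complex.exp (-((lam - 2 * Complex.I * symplFun t z w) * s))) := by
      refine integral_congr_ae (ae_of_all _ fun s => ?_)
      simp only
      have hexp : Complex.exp (-((lam - 2 * Complex.I * symplFun t z w) * s))
          = Complex.exp (-(lam * s)) * Complex.exp (2 * Complex.I * (s * symplFun t z w : ℝ)) := by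
        rw [← Complex.exp_add]
        congr 1
        push_cast
        ring
      rw [hexp]
      ring
    rw [hint, integral_const_mul, integral_pow_mul_cexp hre, hw]
    ring
  have hF : Integrable (Function.uncurry fun (w : Ell2) (s : ℝ) =>
      q w * ((s : ℂ) ^ k * Complex.exp (-(lam * s))) *
        Complex.exp (2 * Complex.I * (s * symplFun t z w : ℝ)))
      ((gaussian t).prod (volume.restrict (Set.Ioi 0))) := by
    refine (hq.mul_prod (integrableOn_pow_mul_cexp hlam k)).mul_bdd (c := 1) ?_
      (ae_of_all _ fun x => (norm_exp_two_I_mul _).le)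
    have := measurable_symplFun t z
    exact Measurable.aestronglyMeasurable (by fun_prop)
  rw [h1, integral_integral_swap hF]
  refine integral_congr_ae (ae_of_all _ fun s => ?_)
  simp only
  rw [inner_weylGroup_eq_integral, ← integral_const_mul]
  refine integral_congr_ae (ae_of_all _ fun w => ?_)
  simp only [q]
  ring

lemma inner_laplaceOp {F : Type*} [NormedAddCommGroup F] [InnerProductSpace ℂ F] [CompleteSpace F]
    {U : ℝ → (F →L[ℂ] F)} (hU : IsContractionGroup U) {lam : ℂ} (hlam : 0 < lam.re) (g f : F) :
    inner ℂ g (laplaceOp hU hlam f)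
      = ∫ s in Set.Ioi (0 : ℝ), Complex.exp (-(lam * s)) * inner ℂ g (U s f) := by
  rw [laplaceOp_apply]
  refine ((innerSL ℂ g).integral_comp_comm (hU.integrableOn_laplace hlam f 0)).symm.trans ?_
  refine integral_congr_ae (ae_of_all _ fun s => ?_)
  simp

lemma opNorm_le_of_norm_inner_le {F : Type*} [NormedAddCommGroup F] [InnerProductSpace ℂ F]
    {T : F →L[ℂ] F} {C : ℝ} (hC : 0 ≤ C) (h : ∀ g f, ‖inner ℂ g (T f)‖ ≤ C * (‖g‖ * ‖f‖)) :
    ‖T‖ ≤ C := by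
  refine ContinuousLinearMap.opNorm_le_bound _ hC fun f => ?_
  have hT := h (T f) f
  rw [← inner_self_re_eq_norm, inner_self_eq_norm_mul_norm] at hT
  rcases (norm_nonneg (T f)).eq_or_lt with h0 | h0
  · rw [← h0]
    positivity
  · refine le_of_mul_le_mul_left ?_ h0
    linarith

/-- The partial sums of the series of Toeplitz operators for the resolvent. -/
def toeplitzPartialSum (t : WeightSequence) (z : cameronMartin t) {lam : ℂ} (hlam : 0 < lam.re)
    (N : ℕ) : Fock t →L[ℂ] Fock t :=
  ∑ n ∈ Finset.range N, (((halfNorm t z ^ 2 / 2) ^ n / n.factorial * (2 * n).factorial : ℝ) : ℂ) •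
    toeplitz t (classicalResolventPow t z hlam (2 * n))

/-- The remainder `1 - e^{-x} ∑_{n < N} xⁿ / n!`, a number in `[0, 1]` for `x ≥ 0`. -/
def expRemainder (N : ℕ) (x : ℝ) : ℝ :=
  1 - Real.exp (-x) * ∑ n ∈ Finset.range N, x ^ n / n.factorial

lemma expRemainder_nonneg (N : ℕ) {x : ℝ} (hx : 0 ≤ x) : 0 ≤ expRemainder N x := by
  rw [expRemainder, sub_nonneg]
  calc _ ≤ Real.exp (-x) * Real.exp x := by
        gcongr; exact Real.sum_le_exp_of_nonneg hx N
    _ = 1 := by rw [← Real.exp_add, neg_add_cancel, Real.exp_zero]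

lemma expRemainder_le_one (N : ℕ) {x : ℝ} (hx : 0 ≤ x) : expRemainder N x ≤ 1 := by
  rw [expRemainder, sub_le_self_iff]
  positivity

lemma tendsto_expRemainder (x : ℝ) : Tendsto (fun N => expRemainder N x) atTop (𝓝 0) := by
  have h := (NormedSpace.expSeries_div_hasSum_exp x).tendsto_sum_nat
  rw [← Real.exp_eq_exp_ℝ] at h
  have := (h.const_mul (Real.exp (-x))).const_sub 1
  rwa [← Real.exp_add, neg_add_cancel, Real.exp_zero, sub_self] at this

lemma continuous_expRemainder (N : ℕ) : Continuous (expRemainder N) := by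
  unfold expRemainder
  fun_prop

lemma inner_laplaceOp_sub_toeplitzPartialSum (t : WeightSequence) (z : cameronMartin t) {lam : ℂ}
    (hlam : 0 < lam.re) (N : ℕ) (g f : Fock t) :
    inner ℂ g ((laplaceOp (isContractionGroup_weylGroup t z) hlam
        - toeplitzPartialSum t z hlam N) f)
      = ∫ s in Set.Ioi (0 : ℝ), (expRemainder N (halfNorm t z ^ 2 / 2 * s ^ 2) : ℂ) *
          (Complex.exp (-(lam * s)) * inner ℂ g (weylGroup (weyl t) z s f)) := by
  set c := halfNorm t z ^ 2 / 2
  have hU := isContractionGroup_weylGroup t z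
  have hmeas : Continuous fun s : ℝ => inner ℂ g (weylGroup (weyl t) z s f) :=
    (innerSL ℂ g).continuous.comp (hU.continuous f)
  have hbase : IntegrableOn (fun s : ℝ => Complex.exp (-(lam * s)) *
      inner ℂ g (weylGroup (weyl t) z s f)) (Set.Ioi 0) := by
    simpa [IntegrableOn] using
      (innerSL ℂ g).integrable_comp (hU.integrableOn_laplace hlam f 0)
  have hterm : ∀ n : ℕ, IntegrableOn (fun s : ℝ => ((c ^ n / n.factorial : ℝ) : ℂ) *
      ((s : ℂ) ^ (2 * n) * Complex.exp (-(lam * s)) *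
        ((Real.exp (-(c * s ^ 2)) : ℂ) * inner ℂ g (weylGroup (weyl t) z s f)))) (Set.Ioi 0) := by
    intro n
    refine ((integrableOn_pow_mul_cexp hlam (2 * n)).mul_bdd (c := ‖g‖ * ‖f‖) ?_
      (ae_of_all _ fun s => ?_)).const_mul _
    · exact Continuous.aestronglyMeasurable (by fun_prop)
    · rw [norm_mul, Complex.norm_real, Real.norm_of_nonneg (Real.exp_pos _).le]
      have h1 : Real.exp (-(c * s ^ 2)) ≤ 1 := Real.exp_le_one_iff.mpr (by
        have : 0 ≤ c := div_nonneg (sq_nonneg _) two_pos.le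
        linarith [mul_nonneg this (sq_nonneg s)])
      have h2 : ‖inner ℂ g (weylGroup (weyl t) z s f)‖ ≤ ‖g‖ * ‖f‖ :=
        (norm_inner_le_norm (𝕜 := ℂ) g _).trans
          (mul_le_mul_of_nonneg_left (hU.norm_apply_le s f) (norm_nonneg g))
      calc _ ≤ 1 * (‖g‖ * ‖f‖) := by gcongr
        _ = _ := one_mul _
  have hsum : inner ℂ g (toeplitzPartialSum t z hlam N f)
      = ∑ n ∈ Finset.range N, ∫ s in Set.Ioi (0 : ℝ), ((c ^ n / n.factorial : ℝ) : ℂ) *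
      ((s : ℂ) ^ (2 * n) * Complex.exp (-(lam * s)) *
        ((Real.exp (-(c * s ^ 2)) : ℂ) * inner ℂ g (weylGroup (weyl t) z s f))) := by
    rw [toeplitzPartialSum, sum_apply, inner_sum]
    refine Finset.sum_congr rfl fun n _ => ?_
    rw [integral_const_mul, ← factorial_mul_inner_toeplitz_classicalResolventPow t z hlam,
      smul_apply, inner_smul_right, ← mul_assoc]
    simp only [c]
    push_cast
    rfl
  rw [sub_apply, inner_sub_right, inner_laplaceOp, hsum,
    ← integral_finsetSum _ fun n _ => hterm n, ← integral_sub hbase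
      (integrable_finsetSum _ fun n _ => hterm n)]
  refine integral_congr_ae (ae_of_all _ fun s => ?_)
  simp only [expRemainder]
  push_cast
  rw [sub_mul, one_mul, Finset.mul_sum, Finset.sum_mul]
  congr 1
  refine Finset.sum_congr rfl fun n _ => ?_
  rw [mul_pow, ← pow_mul]
  ring

/-- The Laplace transform of the Weyl group is the norm limit of linear combinations of the Toeplitz
operators with symbols `(lam - 2iσ(·, z))^{-(2n+1)}`. -/
lemma tendsto_norm_laplaceOp_sub_toeplitzPartialSum (t : WeightSequence) (z : cameronMartin t) {lam : ℂ}
    (hlam : 0 < lam.re) : Tendsto (fun N => ‖laplaceOp (isContractionGroup_weylGroup t z) hlam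
      - toeplitzPartialSum t z hlam N‖) atTop (𝓝 0) := by
  set c := halfNorm t z ^ 2 / 2
  have hc : 0 ≤ c := div_nonneg (sq_nonneg _) two_pos.le
  have hU := isContractionGroup_weylGroup t z
  have hexp : IntegrableOn (fun s : ℝ => Real.exp (-lam.re * s)) (Set.Ioi 0) :=
    integrableOn_exp_mul_Ioi (by linarith) 0
  have hcont : ∀ N, Continuous fun s : ℝ =>
      expRemainder N (c * s ^ 2) * Real.exp (-lam.re * s) := fun N =>
    ((continuous_expRemainder N).comp (by fun_prop)).mul (by fun_prop)
  have hbd : ∀ N (s : ℝ), ‖expRemainder N (c * s ^ 2) * Real.exp (-lam.re * s)‖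
      ≤ Real.exp (-lam.re * s) := by
    intro N s
    have hx : 0 ≤ c * s ^ 2 := by positivity
    rw [norm_mul, Real.norm_of_nonneg (expRemainder_nonneg N hx),
      Real.norm_of_nonneg (Real.exp_pos _).le]
    exact mul_le_of_le_one_left (Real.exp_pos _).le (expRemainder_le_one N hx)
  have hint : ∀ N, IntegrableOn (fun s : ℝ =>
      expRemainder N (c * s ^ 2) * Real.exp (-lam.re * s)) (Set.Ioi 0) := fun N =>
    hexp.mono' (hcont N).aestronglyMeasurable (ae_of_all _ (hbd N))
  have hnorm : ∀ N, ‖laplaceOp hU hlam - toeplitzPartialSum t z hlam N‖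
      ≤ ∫ s in Set.Ioi (0 : ℝ), expRemainder N (c * s ^ 2) * Real.exp (-lam.re * s) := by
    intro N
    set ε := ∫ s in Set.Ioi (0 : ℝ), expRemainder N (c * s ^ 2) * Real.exp (-lam.re * s)
    have hε : 0 ≤ ε := integral_nonneg fun s =>
      mul_nonneg (expRemainder_nonneg N (by positivity)) (Real.exp_pos _).le
    refine opNorm_le_of_norm_inner_le hε fun g f => ?_
    refine (congrArg norm (inner_laplaceOp_sub_toeplitzPartialSum t z hlam N g f)).trans_le ?_
    rw [← integral_mul_const]
    refine norm_integral_le_of_norm_le ((hint N).mul_const _) (ae_of_all _ fun s => ?_)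
    rw [norm_mul, norm_mul, norm_cexp_neg_mul_ofReal, Complex.norm_real,
      Real.norm_of_nonneg (expRemainder_nonneg N (by positivity)), ← mul_assoc]
    exact mul_le_mul_of_nonneg_left ((norm_inner_le_norm (𝕜 := ℂ) g _).trans
      (mul_le_mul_of_nonneg_left (hU.norm_apply_le s f) (norm_nonneg g)))
      (mul_nonneg (expRemainder_nonneg N (by positivity)) (Real.exp_pos _).le)
  have hlim : Tendsto (fun N => ∫ s in Set.Ioi (0 : ℝ),
      expRemainder N (c * s ^ 2) * Real.exp (-lam.re * s)) atTop
      (𝓝 (∫ _ in Set.Ioi (0 : ℝ), (0 : ℝ))) :=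
    tendsto_integral_of_dominated_convergence _ (fun N => (hcont N).aestronglyMeasurable) hexp
      (fun N => ae_of_all _ (hbd N)) (ae_of_all _ fun s => by
        simpa using (tendsto_expRemainder (c * s ^ 2)).mul_const (Real.exp (-lam.re * s)))
  rw [integral_zero] at hlim
  exact squeeze_zero (fun _ => ContinuousLinearMap.opNorm_nonneg _) hnorm hlim

lemma subset_cstarGenerated {F : Type*} [NormedAddCommGroup F] [InnerProductSpace ℂ F]
    [CompleteSpace F] (S : Set (F →L[ℂ] F)) : S ⊆ cstarGenerated S := fun _ hA =>
  StarSubalgebra.le_topologicalClosure _ (StarAlgebra.subset_adjoin ℂ S hA)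

lemma mem_cstarGenerated_of_tendsto {F : Type*} [NormedAddCommGroup F] [InnerProductSpace ℂ F]
    [CompleteSpace F] {S : Set (F →L[ℂ] F)} {A : ℕ → F →L[ℂ] F} {B : F →L[ℂ] F}
    (hA : ∀ N, A N ∈ cstarGenerated S) (h : Tendsto (fun N => ‖B - A N‖) atTop (𝓝 0)) :
    B ∈ cstarGenerated S := by
  simp_rw [norm_sub_rev B] at h
  exact (StarSubalgebra.isClosed_topologicalClosure _).mem_of_tendsto
    (tendsto_iff_norm_sub_tendsto_zero.mpr h) (Eventually.of_forall hA)

lemma cstarGenerated_le {F : Type*} [NormedAddCommGroup F] [InnerProductSpace ℂ F]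
    [CompleteSpace F] {S S' : Set (F →L[ℂ] F)} (h : S ⊆ cstarGenerated S') :
    cstarGenerated S ≤ cstarGenerated S' :=
  StarSubalgebra.topologicalClosure_minimal (StarAlgebra.adjoin_le h)
    (StarSubalgebra.isClosed_topologicalClosure _)

lemma laplaceOp_mem_toeplitzAlgebra (t : WeightSequence) (z : cameronMartin t) {lam : ℂ}
    (hlam : 0 < lam.re) : laplaceOp (isContractionGroup_weylGroup t z) hlam
      ∈ toeplitzAlgebra t (classicalResolventAlgebra t) := by
  refine mem_cstarGenerated_of_tendsto (fun N => sum_mem fun n _ => ?_)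
    (tendsto_norm_laplaceOp_sub_toeplitzPartialSum t z hlam)
  exact SMulMemClass.smul_mem _ (subset_cstarGenerated _
    ⟨_, classicalResolventPow_mem t z hlam (2 * n), rfl⟩)

/-! ### Resolvents of the field operators -/

lemma exists_isResolvent_mem_toeplitzAlgebra (t : WeightSequence) (z : cameronMartin t) {lam : ℂ}
    (hlam : lam.re ≠ 0) : ∃ R ∈ toeplitzAlgebra t (classicalResolventAlgebra t),
      IsResolvent (weylGroup (weyl t) z) lam R := by
  have hneg : ∀ (z : cameronMartin t) (mu : ℂ), 0 < mu.re →
      ∃ R ∈ toeplitzAlgebra t (classicalResolventAlgebra t),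
        IsResolvent (weylGroup (weyl t) z) (-mu) R := fun z mu hmu =>
    ⟨_, SMulMemClass.smul_mem (-Complex.I) (laplaceOp_mem_toeplitzAlgebra t z hmu),
      isResolvent_laplaceOp (isContractionGroup_weylGroup t z) hmu⟩
  rcases hlam.lt_or_gt with h | h
  · simpa using hneg z (-lam) (by simpa using h)
  · obtain ⟨R, hR, hres⟩ := hneg (-z) lam h
    refine ⟨-R, neg_mem hR, ?_⟩
    have hgroup : (fun s => weylGroup (weyl t) (-z) (-s)) = weylGroup (weyl t) z := by
      funext s
      simp [weylGroup]
    simpa [hgroup] using hres.comp_neg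

lemma resolventAlgebra_weyl_le (t : WeightSequence) :
    resolventAlgebra (weyl t) ≤ toeplitzAlgebra t (classicalResolventAlgebra t) := by
  refine cstarGenerated_le ?_
  rintro R ⟨lam, z, hlam, hR⟩
  obtain ⟨R', hR', hres⟩ := exists_isResolvent_mem_toeplitzAlgebra t z hlam
  rw [hR.eq hres]
  exact hR'

end FockBargmann

end

theorem mainTheorem3 (t : WeightSequence) :
    (∃! W : cameronMartin t → (Fock t →L[ℂ] Fock t), IsWeylSystem t W) ∧
    ∀ W : cameronMartin t → (Fock t →L[ℂ] Fock t), IsWeylSystem t W →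
      (∀ z, W z ∈ unitary (Fock t →L[ℂ] Fock t)) ∧
      (∀ z w, W z * W w = Complex.exp (-(Complex.I * (sympl t z w : ℂ))) • W (z + w)) ∧
      (∀ (lam : ℂ) (z : cameronMartin t), lam.re ≠ 0 →
        ∃ R : Fock t →L[ℂ] Fock t, IsResolvent (weylGroup W z) lam R) ∧
      resolventAlgebra W ≤ toeplitzAlgebra t (classicalResolventAlgebra t) := by
  refine ⟨⟨weyl t, isWeylSystem_weyl t, fun W hW => hW.eq_weyl⟩, fun W hW => ?_⟩
  rw [hW.eq_weyl]
  refine ⟨weyl_mem_unitary t, weyl_mul_weyl t, fun lam z hlam => ?_, resolventAlgebra_weyl_le t⟩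
  obtain ⟨R, _, hR⟩ := exists_isResolvent_mem_toeplitzAlgebra t z hlam
  exact ⟨R, hR⟩
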